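/- Let $\rho=\beta+i\gamma$ run over the non-trivial zeros of the Riemann zeta-function ($0<\beta<1$). All sums over zeros $\rho$ or over pairs of zeros $\rho,\rho'$ are taken with multiplicity. For $T>1$ put $L=\frac1{2\pi}\log T$, and define $$N^\circledast(T)=\sum_{\substack{\rho,\rho'\\ 0<\gamma,\gamma'\le T\\ \gamma=\gamma'}}1,\qquad N(T,\lambda)=\sum_{\substack{\rho,\rho'\\ 0<\gamma,\gamma'\le T\\ 0<(\gamma-\gamma')L\le\lambda}}1 .$$ For $M>0$ let $\mathcal P(T,M)$ be the collection of pairs $(\gamma,\gamma')$ of ordinates of zeros with $T/\log^2T<\gamma,\gamma'\le T$ and $|(\gamma-\gamma')L|\le M$, and let $$P_0(T)=\frac1{TL}\,\#\left\{(\gamma,\gamma')\in\mathcal P(T,M):\ -\tfrac14<(\gamma-\gamma')L\le\tfrac14\right\},$$ the pairs being counted with multiplicity. Write $p_0=\lim_{T\to\infty}P_0(T)$ when this limit exists. Assume the hypothesis AH-Pairs: for every $M>0$ there is a positive decreasing function $R$ with $R(T)\to0$ as $T\to\infty$ such that, for all sufficiently large $T$, every $(\gamma,\gamma')\in\mathcal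 P(T,M)$ satisfies $$(\gamma-\gamma')L=\frac k2+O\big((|k|+1)R(T)\big)$$ for some integer $k$, with an implied constant that does not depend on $T$ or on the pair. Then, for every $M>0$, the following are equivalent: (i) the limiting density $p_0$ exists and equals $1$; (ii) (Essential Simplicity Hypothesis) as $T\to\infty$, $N^\circledast(T)=TL+o(TL)$, and $N(T,\lambda_0)=o(TL)$ for every function $\lambda_0=\lambda_0(T)$ with $\lambda_0\to0$ as $T\to\infty$. -/

import Mathlib

namespace ZetaPairs

open Filter Asymptotics Topology

/-- The non-trivial zeros `ρ = β + iγ` of the Riemann zeta function with `0 < γ ≤ T`. -/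
def zeroSet (T : ℝ) : Set ℂ :=
  {ρ | riemannZeta ρ = 0 ∧ 0 < ρ.re ∧ ρ.re < 1 ∧ 0 < ρ.im ∧ ρ.im ≤ T}

theorem zeroSet_finite (T : ℝ) : (zeroSet T).Finite := by
  have hK : IsCompact (Set.Icc (0 : ℝ) 1 ×ℂ Set.Icc (0 : ℝ) T) :=
    isCompact_Icc.reProdIm isCompact_Icc
  refine hK.inter_riemannZetaZeros_finite.subset ?_
  rintro ρ ⟨h0, h1, h2, h3, h4⟩
  refine ⟨?_, h0⟩
  rw [Complex.mem_reProdIm]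
  exact ⟨⟨h1.le, h2.le⟩, ⟨h3.le, h4⟩⟩

/-- The finite set of distinct non-trivial zeros with `0 < γ ≤ T`. -/
noncomputable def zeros (T : ℝ) : Finset ℂ := (zeroSet_finite T).toFinset

/-- The multiplicity `m_ρ` of `ρ` as a zero of the Riemann zeta function. -/
noncomputable def mult (ρ : ℂ) : ℕ := analyticOrderNatAt riemannZeta ρ

/-- `L = log T / (2π)`, the average density of zeros at height `T`. -/
noncomputable def L (T : ℝ) : ℝ := 1 / (2 * Real.pi) * Real.log T

/-- The number of pairs `(ρ, ρ')` in a finite set of pairs of distinct zeros, where each of the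
two zeros is counted with its multiplicity. -/
noncomputable def pairCount (S : Finset (ℂ × ℂ)) : ℕ := ∑ p ∈ S, mult p.1 * mult p.2

open Classical in
/-- `N^⊛(T)`: the number of pairs of zeros with `0 < γ, γ' ≤ T` and `γ = γ'`. -/
noncomputable def NCirc (T : ℝ) : ℕ :=
  pairCount {p ∈ zeros T ×ˢ zeros T | p.1.im = p.2.im}

open Classical in
/-- `N(T, lam)`: the number of pairs of zeros with `0 < γ, γ' ≤ T` and
`0 < (γ - γ') L ≤ lam`. -/
noncomputable def N (T lam : ℝ) : ℕ :=
  pairCount {p ∈ zeros T ×ˢ zeros T |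
    0 < (p.1.im - p.2.im) * L T ∧ (p.1.im - p.2.im) * L T ≤ lam}

open Classical in
/-- `𝒫(T, M)`: the pairs of zeros with `T / log² T < γ, γ' ≤ T` and `|(γ - γ') L| ≤ M`. -/
noncomputable def closePairs (T M : ℝ) : Finset (ℂ × ℂ) :=
  {p ∈ zeros T ×ˢ zeros T | T / Real.log T ^ 2 < p.1.im ∧ T / Real.log T ^ 2 < p.2.im ∧
    |(p.1.im - p.2.im) * L T| ≤ M}

open Classical in
/-- `ℬ_{k/2}(T)`: the pairs in `𝒫(T, M)` with `k/2 - 1/4 < (γ - γ') L ≤ k/2 + 1/4`. -/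
noncomputable def nearPairs (k : ℤ) (M T : ℝ) : Finset (ℂ × ℂ) :=
  {p ∈ closePairs T M | (k : ℝ) / 2 - 1 / 4 < (p.1.im - p.2.im) * L T ∧
    (p.1.im - p.2.im) * L T ≤ (k : ℝ) / 2 + 1 / 4}

/-- The density `P_{k/2}(T) = |ℬ_{k/2}(T)| / (T L)`, pairs being counted with multiplicity. -/
noncomputable def density (k : ℤ) (M T : ℝ) : ℝ := (pairCount (nearPairs k M T) : ℝ) / (T * L T)

/-- The limiting density `p_{k/2}` exists and equals `p`. -/
def HasLimitingDensity (k : ℤ) (M p : ℝ) : Prop := Tendsto (density k M) atTop (𝓝 p)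

/-- The hypothesis AH-Pairs: for every `M > 0` there is a positive decreasing `R` with
`R(T) → 0` such that, for `T` large, every pair in `𝒫(T, M)` satisfies
`(γ - γ') L = k/2 + O((|k| + 1) R(T))` for some integer `k`. -/
def AHPairs : Prop :=
  ∀ M : ℝ, 0 < M → ∃ (R : ℝ → ℝ) (C T₀ : ℝ),
    (∀ T, T₀ ≤ T → 0 < R T) ∧ AntitoneOn R (Set.Ici T₀) ∧ Tendsto R atTop (𝓝 0) ∧
    ∀ T, T₀ ≤ T → ∀ p ∈ closePairs T M, ∃ k : ℤ,
      |(p.1.im - p.2.im) * L T - (k : ℝ) / 2| ≤ C * ((|(k : ℝ)| + 1) * R T)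

/-- The Essential Simplicity Hypothesis: `N^⊛(T) = T L + o(T L)`, and `N(T, lam₀) = o(T L)`
whenever `lam₀ = lam₀(T) → 0` as `T → ∞`. -/
def ESH : Prop :=
  ((fun T : ℝ => (NCirc T : ℝ) - T * L T) =o[atTop] fun T : ℝ => T * L T) ∧
  ∀ lam₀ : ℝ → ℝ, Tendsto lam₀ atTop (𝓝 0) →
    (fun T : ℝ => (N T (lam₀ T) : ℝ)) =o[atTop] fun T : ℝ => T * L T

end ZetaPairs

namespace ZetaPairs

open Filter Asymptotics Topology

/-! ### Growth of the Gamma function in the half plane `1 ≤ re z` -/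

/-! Both conditions say that pairs at normalized distance nearly zero number `T L + o(T L)`. The
cutoff `T / log² T` is harmless: the relevant counts at heights `O(T / log² T)` are `o(T L)`.

From simplicity to density, AH-Pairs forces every pair in the window `(-1/4, 1/4]` to distance
`O(R(T)) = o(1)` (`AHPairs.exists_bound`). Such a pair is counted by `N^⊛(T)` or, up to order, by
`N(T, λ)` with `λ → 0`. Conversely, each pair with `γ = γ'` above the cutoff lies in the window.

From density to simplicity, a recursion on the height removes the cutoff: all pairs at distance at
most a fixed `m < 1/4` number at most `(1 + ε) T L`. They include the disjoint families counted by
`N^⊛(T)` and `N(T, λ)`. Since `m_ρ ≤ m_ρ²`, `N^⊛(T)` is at least the number of zeros up to `T`,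
which is at least `(1 - ε) T L` (`eventually_mul_le_zeroCount`). Little room is left: `N^⊛(T)` is
asymptotic to `T L` and `N(T, λ)` is `o(T L)`.

The zero count, the lower half of the Riemann–von Mangoldt formula, comes from Jensen's formula for
`ξ`. Stirling-type bounds give `log |ξ(1/2 + w)| ≈ |Re w| log |w| / 2` off the critical strip, and
`|Re w|` has mean `2R/π` on `|w| = R`, so the mean of `log |ξ|` is about `R log R / π`. Inside the
strip `log |ξ|` may be very negative; the Poisson–Jensen inequality at points close to `± iR` where
`ξ` is not small bounds that loss (`exists_le_meanLogXi`). Comparing the means at radii `T` and `T /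
(1 + δ)` bounds the number of zeros from below. -/

theorem norm_Gamma_le_Gamma_re {z : ℂ} (hz : 0 < z.re) : ‖Complex.Gamma z‖ ≤ Real.Gamma z.re := by
  rw [Complex.Gamma_eq_integral hz, Real.Gamma_eq_integral hz, Complex.GammaIntegral]
  refine (MeasureTheory.norm_integral_le_integral_norm _).trans (le_of_eq ?_)
  refine MeasureTheory.setIntegral_congr_fun measurableSet_Ioi fun x hx => ?_
  simp only [norm_mul, Complex.norm_real, Real.norm_eq_abs, abs_of_pos (Real.exp_pos _)]
  rw [Complex.norm_cpow_eq_rpow_re_of_pos hx]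
  simp

/-- By convexity `Γ` lies below its chord on `[1, 2]`, whose endpoints both have height `1`. -/
theorem Gamma_le_one_of_mem_Icc {x : ℝ} (h1 : 1 ≤ x) (h2 : x ≤ 2) : Real.Gamma x ≤ 1 := by
  have := Real.convexOn_Gamma.2 (show (1 : ℝ) ∈ Set.Ioi 0 by simp)
    (show (2 : ℝ) ∈ Set.Ioi 0 by simp)
    (show 0 ≤ 2 - x by linarith) (show 0 ≤ x - 1 by linarith) (by ring)
  simp only [smul_eq_mul, Real.Gamma_one, Real.Gamma_two] at this
  have e : (2 - x) * 1 + (x - 1) * 2 = x := by ring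
  rw [e] at this
  linarith

theorem Gamma_le_exp_mul_log {x : ℝ} (h1 : 1 ≤ x) : Real.Gamma x ≤ Real.exp (x * Real.log x) := by
  obtain ⟨n, hn⟩ := exists_nat_ge x
  have hn' : x ≤ n + 2 := by linarith
  clear hn
  induction n generalizing x with
  | zero =>
    refine (Gamma_le_one_of_mem_Icc h1 (by simpa using hn')).trans (Real.one_le_exp ?_)
    exact mul_nonneg (by linarith) (Real.log_nonneg h1)
  | succ n ih =>
    by_cases h2 : x ≤ 2
    · refine (Gamma_le_one_of_mem_Icc h1 h2).trans (Real.one_le_exp ?_)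
      exact mul_nonneg (by linarith) (Real.log_nonneg h1)
    · push Not at h2
      have hx : 1 ≤ x - 1 := by linarith
      have e : Real.Gamma x = (x - 1) * Real.Gamma (x - 1) := by
        rw [← Real.Gamma_add_one (by linarith)]; ring_nf
      have h3 := ih hx (by push_cast at hn'; linarith)
      rw [e]
      calc (x - 1) * Real.Gamma (x - 1)
          ≤ Real.exp (Real.log (x - 1)) * Real.exp ((x - 1) * Real.log (x - 1)) := by
            rw [Real.exp_log (by linarith)]
            gcongr
        _ = Real.exp (x * Real.log (x - 1)) := by rw [← Real.exp_add]; ring_nf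
        _ ≤ _ := by
            gcongr
            linarith

theorem norm_Gamma_le_exp {z : ℂ} (hz : 1 ≤ z.re) :
    ‖Complex.Gamma z‖ ≤ Real.exp (z.re * Real.log ‖z‖) := by
  refine (norm_Gamma_le_Gamma_re (by linarith)).trans ((Gamma_le_exp_mul_log hz).trans ?_)
  have := Complex.re_le_norm z
  gcongr

/-- Compactness handles `|Im z| ≤ 1`. Beyond that the reflection formula gives `|Γ(z)| = π / (|Γ(1 -
z)| |sin πz|)`, and both factors in the denominator are bounded above. -/
theorem exists_le_norm_Gamma_strip : ∃ c : ℝ, 0 < c ∧ ∀ z : ℂ, 1 ≤ z.re → z.re ≤ 2 →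
    c * Real.exp (-(Real.pi * |z.im|)) ≤ ‖Complex.Gamma z‖ := by
  have hK : IsCompact (Set.Icc (1 : ℝ) 2 ×ℂ Set.Icc (-1 : ℝ) 1) :=
    isCompact_Icc.reProdIm isCompact_Icc
  have hcont : ContinuousOn (fun z => ‖Complex.Gamma z‖)
      (Set.Icc (1 : ℝ) 2 ×ℂ Set.Icc (-1 : ℝ) 1) := by
    intro z hz
    rw [Complex.mem_reProdIm] at hz
    have : DifferentiableAt ℂ Complex.Gamma z := by
      refine Complex.differentiableAt_Gamma _ fun m hm => ?_
      have := hz.1.1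
      rw [hm] at this
      simp at this
      have : (0 : ℝ) ≤ m := by positivity
      linarith
    exact this.continuousAt.norm.continuousWithinAt
  have hne : (Set.Icc (1 : ℝ) 2 ×ℂ Set.Icc (-1 : ℝ) 1).Nonempty :=
    ⟨1, by rw [Complex.mem_reProdIm]; simp⟩
  obtain ⟨z₀, hz₀, hmin⟩ := hK.exists_isMinOn hne hcont
  rw [Complex.mem_reProdIm] at hz₀
  have hpos : 0 < ‖Complex.Gamma z₀‖ :=
    norm_pos_iff.2 (Complex.Gamma_ne_zero_of_re_pos (by have := hz₀.1.1; linarith))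
  refine ⟨min ‖Complex.Gamma z₀‖ 1, lt_min hpos one_pos, fun z h1 h2 => ?_⟩
  by_cases hy : |z.im| ≤ 1
  · have h3 := hmin (show z ∈ _ from Complex.mem_reProdIm.2 ⟨⟨h1, h2⟩, abs_le.1 hy⟩)
    have h4 : Real.exp (-(Real.pi * |z.im|)) ≤ 1 := by
      rw [Real.exp_le_one_iff]; have := Real.pi_pos; nlinarith [abs_nonneg z.im]
    calc _ ≤ ‖Complex.Gamma z₀‖ * 1 := by gcongr; exact min_le_left _ _
      _ ≤ _ := by simpa using h3
  · push Not at hy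
    have him (w : ℂ) (h : w.im ≠ 0) : w ≠ 0 := by rintro rfl; simp at h
    have hy0 : z.im ≠ 0 := by intro h; simp [h] at hy; linarith
    have hz1 : (1 - z) ≠ 0 := him _ (by simpa using hy0)
    have hz2 : (2 - z) ≠ 0 := him _ (by simpa using hy0)
    have e1 : Complex.Gamma (2 - z) = (1 - z) * Complex.Gamma (1 - z) := by
      rw [← Complex.Gamma_add_one _ hz1]; ring_nf
    have e2 : Complex.Gamma (3 - z) = (2 - z) * Complex.Gamma (2 - z) := by
      rw [← Complex.Gamma_add_one _ hz2]; ring_nf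
    have n1 : 1 ≤ ‖1 - z‖ := by
      have := Complex.abs_im_le_norm (1 - z); simp at this; linarith
    have n2 : 1 ≤ ‖2 - z‖ := by
      have := Complex.abs_im_le_norm (2 - z); simp at this; linarith
    have g3 : ‖Complex.Gamma (3 - z)‖ ≤ 1 := by
      refine (norm_Gamma_le_Gamma_re (by simp; linarith)).trans ?_
      apply Gamma_le_one_of_mem_Icc <;> simp <;> linarith
    -- Two steps of the functional equation move `1 - z` to `3 - z`, whose real part lies in `[1,
    -- 2]`; the factors removed have modulus at least `1`.
    have g1 : ‖Complex.Gamma (1 - z)‖ ≤ 1 := by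
      rw [e2, e1, norm_mul, norm_mul] at g3
      calc ‖Complex.Gamma (1 - z)‖ = 1 * (1 * ‖Complex.Gamma (1 - z)‖) := by ring
        _ ≤ _ := by gcongr
        _ ≤ 1 := g3
    have hrefl := Complex.Gamma_mul_Gamma_one_sub z
    have hsin : ‖Complex.sin (Real.pi * z)‖ ≤ Real.exp (Real.pi * |z.im|) := by
      rw [Complex.sin]
      have ea : ‖Complex.exp (-(Real.pi * z) * Complex.I)‖ ≤ Real.exp (Real.pi * |z.im|) := by
        rw [Complex.norm_exp]
        gcongr
        simp
        have := Real.pi_pos; nlinarith [le_abs_self z.im]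
      have eb : ‖Complex.exp ((Real.pi * z) * Complex.I)‖ ≤ Real.exp (Real.pi * |z.im|) := by
        rw [Complex.norm_exp]
        gcongr
        simp
        have := Real.pi_pos; nlinarith [neg_abs_le z.im]
      have := norm_sub_le (Complex.exp (-(Real.pi * z) * Complex.I))
        (Complex.exp ((Real.pi * z) * Complex.I))
      rw [norm_div, norm_mul]
      simp only [Complex.norm_I, mul_one, Complex.norm_ofNat]
      linarith
    have hsin0 : Complex.sin (Real.pi * z) ≠ 0 := by
      rw [Complex.sin_ne_zero_iff]
      intro k hk
      apply hy0
      have h5 : z = k := by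
        have hpi : (Real.pi : ℂ) ≠ 0 := by exact_mod_cast Real.pi_ne_zero
        apply mul_left_cancel₀ hpi; rw [hk]; ring
      rw [h5]; simp
    have hn : ‖Complex.Gamma z‖ * ‖Complex.Gamma (1 - z)‖ * ‖Complex.sin (Real.pi * z)‖
        = Real.pi := by
      rw [← norm_mul, ← norm_mul, hrefl, div_mul_cancel₀ _ hsin0]
      simp [Real.pi_pos.le]
    have h6 : Real.pi ≤ ‖Complex.Gamma z‖ * 1 * Real.exp (Real.pi * |z.im|) := by
      refine hn.symm.le.trans ?_
      gcongr
    rw [mul_one] at h6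
    calc _ ≤ Real.pi * Real.exp (-(Real.pi * |z.im|)) := by
          gcongr
          exact (min_le_right _ _).trans (by linarith [Real.pi_gt_three])
      _ ≤ ‖Complex.Gamma z‖ * Real.exp (Real.pi * |z.im|) * Real.exp (-(Real.pi * |z.im|)) := by
          gcongr
      _ = _ := by rw [mul_assoc, ← Real.exp_add]; simp

/-- The strip bound is propagated to the right by `|Γ(z)| ≥ (Re z - 1) |Γ(z - 1)|`. Afterwards `log
(Re z)` is replaced by `log ‖z‖`, at a cost of at most `‖z‖` because `x log (‖z‖ / x) ≤ ‖z‖`. -/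
theorem exists_exp_le_norm_Gamma : ∃ C : ℝ, 0 ≤ C ∧ ∀ z : ℂ, 1 ≤ z.re →
    Real.exp (z.re * Real.log ‖z‖ - C * ‖z‖) ≤ ‖Complex.Gamma z‖ := by
  obtain ⟨c, hc, hstrip⟩ := exists_le_norm_Gamma_strip
  have key : ∀ n : ℕ, ∀ z : ℂ, 1 ≤ z.re → z.re ≤ n + 2 →
      c * Real.exp (-(Real.pi * |z.im|)) * Real.exp (z.re * Real.log z.re - 2 * z.re)
        ≤ ‖Complex.Gamma z‖ := by
    have base : ∀ z : ℂ, 1 ≤ z.re → z.re ≤ 2 →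
        c * Real.exp (-(Real.pi * |z.im|)) * Real.exp (z.re * Real.log z.re - 2 * z.re)
        ≤ ‖Complex.Gamma z‖ := by
      intro z h1 h2
      have h3 : Real.exp (z.re * Real.log z.re - 2 * z.re) ≤ 1 := by
        rw [Real.exp_le_one_iff]
        have := Real.log_le_sub_one_of_pos (show 0 < z.re by linarith)
        nlinarith
      calc _ ≤ c * Real.exp (-(Real.pi * |z.im|)) * 1 := by gcongr
        _ ≤ _ := by simpa using hstrip z h1 h2
    intro n
    induction n with
    | zero => intro z h1 h2; exact base z h1 (by simpa using h2)
    | succ n ih =>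
      intro z h1 h2
      by_cases h3 : z.re ≤ 2
      · exact base z h1 h3
      push Not at h3
      have hz1 : z - 1 ≠ 0 := by
        intro h; have := congrArg Complex.re h; simp at this; linarith
      have e : Complex.Gamma z = (z - 1) * Complex.Gamma (z - 1) := by
        rw [← Complex.Gamma_add_one _ hz1]; ring_nf
      have h4 := ih (z - 1) (by simp; linarith) (by simp; push_cast at h2; linarith)
      simp only [Complex.sub_re, Complex.one_re, Complex.sub_im, Complex.one_im, sub_zero] at h4
      have h5 : z.re - 1 ≤ ‖z - 1‖ := by simpa using Complex.re_le_norm (z - 1)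
      set x := z.re with hx
      -- This reduces to `x (log x - log (x - 1)) ≤ x / (x - 1) ≤ 2` for `x > 2`; the term `-2x` in
      -- the induction hypothesis supplies exactly this slack.
      have hlog : Real.exp (x * Real.log x - 2 * x) ≤
          (x - 1) * Real.exp ((x - 1) * Real.log (x - 1) - 2 * (x - 1)) := by
        have e3 : (x - 1) * Real.exp ((x - 1) * Real.log (x - 1) - 2 * (x - 1)) =
            Real.exp (Real.log (x - 1) + ((x - 1) * Real.log (x - 1) - 2 * (x - 1))) := by
          rw [Real.exp_add, Real.exp_log (by linarith)]
        rw [e3]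
        gcongr
        have h6 := Real.log_le_sub_one_of_pos (show 0 < x / (x - 1) by
          apply div_pos <;> linarith)
        rw [Real.log_div (by linarith) (by linarith)] at h6
        have h7 : x * (x / (x - 1) - 1) ≤ 2 := by
          have : x / (x - 1) - 1 = 1 / (x - 1) := by field_simp [show x - 1 ≠ 0 by linarith]; ring
          rw [this, mul_one_div, div_le_iff₀ (by linarith)]
          linarith
        nlinarith
      rw [e, norm_mul]
      calc _ ≤ c * Real.exp (-(Real.pi * |z.im|)) *
            ((x - 1) * Real.exp ((x - 1) * Real.log (x - 1) - 2 * (x - 1))) := by gcongr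
        _ = (x - 1) * (c * Real.exp (-(Real.pi * |z.im|)) *
            Real.exp ((x - 1) * Real.log (x - 1) - 2 * (x - 1))) := by ring
        _ ≤ _ := by
          apply mul_le_mul h5 h4 (by positivity) (norm_nonneg _)
  refine ⟨|Real.log c| + Real.pi + 3, by positivity, fun z hz => ?_⟩
  obtain ⟨n, hn⟩ := exists_nat_ge z.re
  refine le_trans ?_ (key n z hz (by linarith))
  nth_rewrite 2 [← Real.exp_log hc]
  rw [← Real.exp_add, ← Real.exp_add]
  gcongr
  have hzn := Complex.re_le_norm z
  have hzi := Complex.abs_im_le_norm z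
  have h1 : z.re * (Real.log ‖z‖ - Real.log z.re) ≤ ‖z‖ := by
    rw [← Real.log_div (by linarith) (by linarith)]
    have := Real.log_le_sub_one_of_pos (show 0 < ‖z‖ / z.re by apply div_pos <;> linarith)
    calc _ ≤ z.re * (‖z‖ / z.re) := by gcongr; linarith
      _ = _ := by field_simp [show z.re ≠ 0 by linarith]
  have h2 : -(|Real.log c| * ‖z‖) ≤ Real.log c := by
    have := neg_abs_le (Real.log c)
    nlinarith [abs_nonneg (Real.log c)]
  have := Real.pi_pos
  nlinarith

/-! ### The completed zeta function, centred on the critical line -/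

/-- The entire function `ξ(s) = s (s - 1) Λ(s)`, up to a constant factor. -/
noncomputable def xi (s : ℂ) : ℂ := s * (s - 1) * completedRiemannZeta₀ s + 1

theorem differentiable_xi : Differentiable ℂ xi :=
  ((differentiable_id.mul (differentiable_id.sub_const 1)).mul
    differentiable_completedZeta₀).add_const 1

theorem xi_one_sub (s : ℂ) : xi (1 - s) = xi s := by
  rw [xi, xi, completedRiemannZeta₀_one_sub]; ring

theorem xi_eq_mul_completedRiemannZeta {s : ℂ} (h0 : s ≠ 0) (h1 : s ≠ 1) :
    xi s = s * (s - 1) * completedRiemannZeta s := by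
  have h2 : 1 - s ≠ 0 := sub_ne_zero.2 h1.symm
  rw [xi, completedRiemannZeta_eq]
  field_simp
  ring

theorem xi_eq_mul_riemannZeta {s : ℂ} (h0 : 0 < s.re) (h1 : s ≠ 1) :
    xi s = s * (s - 1) * (Complex.Gammaℝ s * riemannZeta s) := by
  have hs : s ≠ 0 := by rintro rfl; simp at h0
  rw [xi_eq_mul_completedRiemannZeta hs h1, riemannZeta_def_of_ne_zero hs,
    mul_div_cancel₀ _ (Complex.Gammaℝ_ne_zero_of_re_pos h0)]

theorem xi_ne_zero_of_one_le_re {s : ℂ} (hs : 1 ≤ s.re) : xi s ≠ 0 := by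
  rcases eq_or_ne s 1 with rfl | h1
  · simp [xi]
  have hs0 : s ≠ 0 := by rintro rfl; norm_num at hs
  rw [xi_eq_mul_riemannZeta (by linarith) h1]
  exact mul_ne_zero (mul_ne_zero hs0 (sub_ne_zero.2 h1))
    (mul_ne_zero (Complex.Gammaℝ_ne_zero_of_re_pos (by linarith))
      (riemannZeta_ne_zero_of_one_le_re hs))

theorem re_mem_Ioo_of_xi_eq_zero {s : ℂ} (hs : xi s = 0) : 0 < s.re ∧ s.re < 1 := by
  constructor
  · by_contra! h
    exact xi_ne_zero_of_one_le_re (s := 1 - s) (by simp; linarith) (by rw [xi_one_sub, hs])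
  · by_contra! h
    exact xi_ne_zero_of_one_le_re h hs

/-- In the open strip the factors relating `ξ` and `ζ` have neither zeros nor poles. Multiplying by
the entire function `1 / Γ_ℝ` keeps every factor analytic. -/
theorem analyticOrderAt_xi {s : ℂ} (h0 : 0 < s.re) (h1 : s.re < 1) :
    analyticOrderAt xi s = analyticOrderAt riemannZeta s := by
  have hs0 : s ≠ 0 := by rintro rfl; simp at h0
  have hs1 : s ≠ 1 := by rintro rfl; simp at h1
  have hpoly : AnalyticAt ℂ (fun z : ℂ => z * (z - 1)) s := by fun_prop
  have hG : AnalyticAt ℂ (fun z => (Complex.Gammaℝ z)⁻¹) s :=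
    Complex.differentiable_Gammaℝ_inv.analyticAt s
  have hz : AnalyticAt ℂ riemannZeta s := analyticOn_riemannZeta s hs1
  have hx : AnalyticAt ℂ xi s := differentiable_xi.analyticAt s
  have e : (xi * fun z => (Complex.Gammaℝ z)⁻¹) =ᶠ[𝓝 s]
      ((fun z : ℂ => z * (z - 1)) * riemannZeta) := by
    have ev1 : ∀ᶠ z : ℂ in 𝓝 s, 0 < z.re :=
      Complex.continuous_re.continuousAt.eventually (lt_mem_nhds h0)
    filter_upwards [ev1, eventually_ne_nhds hs1] with z hz0 hz1
    have := Complex.Gammaℝ_ne_zero_of_re_pos hz0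
    simp only [Pi.mul_apply, xi_eq_mul_riemannZeta hz0 hz1]
    field_simp
  have h := analyticOrderAt_congr e
  rw [analyticOrderAt_mul hx hG, analyticOrderAt_mul hpoly hz,
    hpoly.analyticOrderAt_eq_zero.2 (mul_ne_zero hs0 (sub_ne_zero.2 hs1)),
    hG.analyticOrderAt_eq_zero.2 (inv_ne_zero (Complex.Gammaℝ_ne_zero_of_re_pos h0))] at h
  simpa using h

/-! ### Size of `ξ`: an upper bound everywhere, a lower bound off the critical strip -/

theorem norm_riemannZeta_sub_one_le {s : ℂ} (hs : 2 ≤ s.re) : ‖riemannZeta s - 1‖ ≤ 3 / 4 := by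
  have h1 : 1 < s.re := by linarith
  have hsum : Summable fun n : ℕ => 1 / (n + 1 : ℂ) ^ s := by
    have := (summable_nat_add_iff (f := fun n : ℕ => 1 / (n : ℂ) ^ s) 1).2
      (Complex.summable_one_div_nat_cpow.2 h1)
    simpa using this
  have hz2 := hasSum_zeta_two
  have hz2' : HasSum (fun n : ℕ => 1 / ((n + 1 + 1 : ℕ) : ℝ) ^ 2) (Real.pi ^ 2 / 6 - 1) := by
    have := (hasSum_nat_add_iff' 2).2 hz2
    simpa [Finset.sum_range_succ, add_assoc, one_add_one_eq_two] using this
  rw [zeta_eq_tsum_one_div_nat_add_one_cpow h1, hsum.tsum_eq_zero_add]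
  simp only [Nat.cast_zero, zero_add, Complex.one_cpow, div_one, add_sub_cancel_left]
  refine (tsum_of_norm_bounded hz2' fun n => ?_).trans ?_
  · rw [norm_div, norm_one]
    have e : (((n + 1 : ℕ) : ℂ) + 1) = ((n + 1 + 1 : ℕ) : ℂ) := by push_cast; ring
    rw [e, Complex.norm_natCast_cpow_of_pos (by positivity)]
    gcongr
    rw [← Real.rpow_natCast]
    apply Real.rpow_le_rpow_of_exponent_le
    · push_cast; linarith [n.cast_nonneg (α := ℝ)]
    · exact_mod_cast hs
  · have := Real.pi_lt_d2
    have := Real.pi_pos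
    nlinarith

/-- `Λ₀` is a Mellin transform that converges absolutely for every `s`, and `t ^ (σ / 2 - 1)` is at
most the sum of its values at the two ends of the strip. -/
theorem exists_norm_completedRiemannZeta₀_le (a b : ℝ) : ∃ K : ℝ, 0 ≤ K ∧ ∀ s : ℂ, a ≤ s.re →
    s.re ≤ b → ‖completedRiemannZeta₀ s‖ ≤ K := by
  let P := HurwitzZeta.hurwitzEvenFEPair 0
  have hconv (s : ℂ) : MellinConvergent P.f_modif s :=
    (P.isStrongFEPair_toStrongFEPair.hasMellin s).1
  let I (σ : ℝ) : ℝ := ∫ t in Set.Ioi (0 : ℝ), ‖(t : ℂ) ^ (((σ / 2 : ℝ) : ℂ) - 1) • P.f_modif t‖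
  have hI0 (σ : ℝ) : 0 ≤ I σ := MeasureTheory.integral_nonneg fun _ => norm_nonneg _
  refine ⟨(I a + I b) / 2, by have := hI0 a; have := hI0 b; positivity, fun s h1 h2 => ?_⟩
  have e : completedRiemannZeta₀ s = mellin P.f_modif (s / 2) / 2 := rfl
  rw [e, norm_div, Complex.norm_ofNat]
  gcongr
  rw [mellin, ← MeasureTheory.integral_add (hconv _).norm (hconv _).norm]
  refine (MeasureTheory.norm_integral_le_integral_norm _).trans ?_
  refine MeasureTheory.setIntegral_mono_on (hconv _).norm
    ((hconv _).norm.add (hconv _).norm) measurableSet_Ioi fun t ht => ?_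
  have ht' : (0 : ℝ) < t := ht
  simp only [norm_smul, Complex.norm_cpow_eq_rpow_re_of_pos ht']
  rw [← add_mul]
  gcongr
  simp only [Complex.sub_re, Complex.one_re, Complex.ofReal_re]
  have e2 : (s / 2).re = s.re / 2 := by simp
  rw [e2]
  rcases le_total 1 t with h | h
  · have := Real.rpow_le_rpow_of_exponent_le h (show s.re / 2 - 1 ≤ b / 2 - 1 by linarith)
    have := Real.rpow_nonneg ht'.le (a / 2 - 1)
    linarith
  · have := Real.rpow_le_rpow_of_exponent_ge ht' h (show a / 2 - 1 ≤ s.re / 2 - 1 by linarith)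
    have := Real.rpow_nonneg ht'.le (b / 2 - 1)
    linarith

/-- The function `ξ` with the centre of symmetry moved to the origin. -/
noncomputable def centeredXi (w : ℂ) : ℂ := xi (1 / 2 + w)

theorem centeredXi_neg (w : ℂ) : centeredXi (-w) = centeredXi w := by
  rw [centeredXi, centeredXi, ← xi_one_sub]; ring_nf

theorem differentiable_centeredXi : Differentiable ℂ centeredXi :=
  differentiable_xi.comp (differentiable_id.const_add _)

theorem norm_xi_eq {s : ℂ} (hs : 2 ≤ s.re) : ‖xi s‖ = ‖s‖ * ‖s - 1‖ *
    (Real.exp (-(s.re / 2 * Real.log Real.pi)) * ‖Complex.Gamma (s / 2)‖ * ‖riemannZeta s‖) := by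
  have h1 : s ≠ 1 := by rintro rfl; norm_num at hs
  rw [xi_eq_mul_riemannZeta (by linarith) h1, Complex.Gammaℝ_def]
  simp only [norm_mul]
  rw [Complex.norm_cpow_eq_rpow_re_of_pos Real.pi_pos, Real.rpow_def_of_pos Real.pi_pos]
  simp
  ring_nf
  simp

/-- By evenness `Re w ≥ 0` suffices. For `Re w ≥ 3/2` the Gamma bound gives the main term and `ζ` is
bounded; in the remaining strip `Λ₀` is bounded and `ξ` grows only polynomially. -/
theorem exists_norm_centeredXi_le : ∃ C : ℝ, 0 ≤ C ∧ ∀ w : ℂ, 2 ≤ ‖w‖ →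
    ‖centeredXi w‖ ≤ Real.exp (1 / 2 * |w.re| * Real.log ‖w‖ + C * ‖w‖) := by
  obtain ⟨K, hK0, hK⟩ := exists_norm_completedRiemannZeta₀_le (1 / 2) 2
  have main : ∀ w : ℂ, 2 ≤ ‖w‖ → 0 ≤ w.re →
      ‖centeredXi w‖ ≤ Real.exp (1 / 2 * w.re * Real.log ‖w‖ + (K + 10) * ‖w‖) := by
    intro w hw hre
    have hlog : 0 ≤ Real.log ‖w‖ := Real.log_nonneg (by linarith)
    have hlog' : Real.log ‖w‖ ≤ ‖w‖ := by
      have := Real.log_le_sub_one_of_pos (show 0 < ‖w‖ by linarith); linarith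
    have hs1 : ‖1 / 2 + w‖ ≤ 2 * ‖w‖ := by
      refine (norm_add_le _ _).trans ?_; norm_num; linarith
    have hs2 : ‖1 / 2 + w - 1‖ ≤ 2 * ‖w‖ := by
      have : (1 / 2 + w - 1 : ℂ) = w - 1 / 2 := by ring
      rw [this]
      refine (norm_sub_le _ _).trans ?_; norm_num; linarith
    have hsq : ‖1 / 2 + w‖ * ‖1 / 2 + w - 1‖ ≤ Real.exp (4 * ‖w‖) := by
      have h5 : 2 * ‖w‖ ≤ Real.exp (2 * ‖w‖) := by
        have := Real.add_one_le_exp (2 * ‖w‖); linarith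
      calc _ ≤ Real.exp (2 * ‖w‖) * Real.exp (2 * ‖w‖) := by
            gcongr
            · exact hs1.trans h5
            · exact hs2.trans h5
        _ = _ := by rw [← Real.exp_add]; ring_nf
    have hre' : (1 / 2 + w).re = 1 / 2 + w.re := by simp
    by_cases h : 2 ≤ (1 / 2 + w).re
    · rw [centeredXi, norm_xi_eq h]
      have hz : ‖riemannZeta (1 / 2 + w)‖ ≤ Real.exp ‖w‖ := by
        have h6 := norm_riemannZeta_sub_one_le h
        have h7 := norm_sub_norm_le (riemannZeta (1 / 2 + w)) 1
        have h8 := Real.add_one_le_exp ‖w‖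
        simp at h7
        linarith
      have hpi : Real.exp (-((1 / 2 + w).re / 2 * Real.log Real.pi)) ≤ 1 := by
        rw [Real.exp_le_one_iff]
        have := Real.log_nonneg (show 1 ≤ Real.pi by linarith [Real.pi_gt_three])
        have : 0 ≤ (1 / 2 + w).re / 2 * Real.log Real.pi := by positivity
        linarith
      have hG : ‖Complex.Gamma ((1 / 2 + w) / 2)‖ ≤
          Real.exp (1 / 2 * w.re * Real.log ‖w‖ + ‖w‖) := by
        have e3 : ((1 / 2 + w) / 2).re = (1 / 2 + w.re) / 2 := by simp
        refine (norm_Gamma_le_exp (by rw [e3]; linarith)).trans ?_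
        gcongr
        rw [e3]
        have h9 : Real.log ‖(1 / 2 + w) / 2‖ ≤ Real.log ‖w‖ := by
          apply Real.log_le_log
          · apply norm_pos_iff.2
            intro h0
            have := congrArg Complex.re h0
            rw [e3] at this
            simp at this
            linarith
          · rw [norm_div, Complex.norm_ofNat]; linarith
        nlinarith
      calc _ ≤ Real.exp (4 * ‖w‖) *
            (1 * Real.exp (1 / 2 * w.re * Real.log ‖w‖ + ‖w‖) * Real.exp ‖w‖) := by gcongr
        _ = Real.exp (1 / 2 * w.re * Real.log ‖w‖ + 6 * ‖w‖) := by
            rw [one_mul, ← Real.exp_add, ← Real.exp_add]; ring_nf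
        _ ≤ _ := by
            gcongr
            linarith
    · push Not at h
      have h9 := hK (1 / 2 + w) (by rw [hre']; linarith) h.le
      rw [centeredXi, xi]
      have h10 : K ≤ Real.exp (K * ‖w‖) := by
        have := Real.add_one_le_exp (K * ‖w‖); nlinarith
      calc _ ≤ ‖1 / 2 + w‖ * ‖1 / 2 + w - 1‖ * ‖completedRiemannZeta₀ (1 / 2 + w)‖ + 1 := by
            refine (norm_add_le _ _).trans ?_
            simp
        _ ≤ Real.exp (4 * ‖w‖) * Real.exp (K * ‖w‖) + 1 := by gcongr; exact h9.trans h10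
        _ = Real.exp ((K + 4) * ‖w‖) + 1 := by rw [← Real.exp_add]; ring_nf
        _ ≤ Real.exp ((K + 4) * ‖w‖) * Real.exp (6 * ‖w‖) := by
            have h11 : 1 ≤ Real.exp ((K + 4) * ‖w‖) := Real.one_le_exp (by positivity)
            have h12 : 2 ≤ Real.exp (6 * ‖w‖) := by
              have := Real.add_one_le_exp (6 * ‖w‖); linarith
            nlinarith
        _ = Real.exp ((K + 10) * ‖w‖) := by rw [← Real.exp_add]; ring_nf
        _ ≤ _ := by
            gcongr
            have : 0 ≤ 1 / 2 * w.re * Real.log ‖w‖ := by positivity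
            linarith
  refine ⟨K + 10, by positivity, fun w hw => ?_⟩
  rcases le_total 0 w.re with h | h
  · rw [abs_of_nonneg h]; exact main w hw h
  · rw [abs_of_nonpos h]
    have := main (-w) (by simpa using hw) (by simpa using h)
    simpa [centeredXi_neg] using this

/-- The condition `|Re w| ≥ 3/2` brings the argument, after reflection, to `Re s ≥ 2`, where `|ζ(s)|
≥ 1/4` and the lower bound for `Γ(s/2)` applies. -/
theorem exists_exp_le_norm_centeredXi : ∃ C : ℝ, 0 ≤ C ∧ ∀ w : ℂ, 2 ≤ ‖w‖ → 3 / 2 ≤ |w.re| →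
    Real.exp (1 / 2 * |w.re| * Real.log ‖w‖ - C * ‖w‖) ≤ ‖centeredXi w‖ := by
  obtain ⟨C, hC0, hC⟩ := exists_exp_le_norm_Gamma
  have main : ∀ w : ℂ, 2 ≤ ‖w‖ → 3 / 2 ≤ w.re →
      Real.exp (1 / 2 * w.re * Real.log ‖w‖ - (C + 6) * ‖w‖) ≤ ‖centeredXi w‖ := by
    intro w hw hre
    have hlog : 0 ≤ Real.log ‖w‖ := Real.log_nonneg (by linarith)
    have hlog' : Real.log ‖w‖ ≤ ‖w‖ := by
      have := Real.log_le_sub_one_of_pos (show 0 < ‖w‖ by linarith); linarith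
    have hre' : (1 / 2 + w).re = 1 / 2 + w.re := by simp
    have hrew := Complex.re_le_norm w
    have h : 2 ≤ (1 / 2 + w).re := by rw [hre']; linarith
    have hs1 : ‖1 / 2 + w‖ ≤ 2 * ‖w‖ := by
      refine (norm_add_le _ _).trans ?_; norm_num; linarith
    have hs3 : ‖w‖ ≤ ‖1 / 2 + w‖ := by
      rw [← sq_le_sq₀ (norm_nonneg _) (norm_nonneg _), ← Complex.normSq_eq_norm_sq,
        ← Complex.normSq_eq_norm_sq, Complex.normSq_apply, Complex.normSq_apply]
      simp
      nlinarith
    have hs4 : 1 ≤ ‖1 / 2 + w - 1‖ := by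
      have := Complex.re_le_norm (1 / 2 + w - 1)
      simp at this
      norm_num at this ⊢
      linarith
    rw [centeredXi, norm_xi_eq h]
    have hz : Real.exp (-‖w‖) ≤ ‖riemannZeta (1 / 2 + w)‖ := by
      have h6 := norm_riemannZeta_sub_one_le h
      have h7 := norm_sub_norm_le 1 (riemannZeta (1 / 2 + w))
      rw [norm_sub_rev, norm_one] at h7
      have h8 : Real.exp (-‖w‖) ≤ 1 / 4 := by
        rw [Real.exp_neg]
        have h9 : 4 ≤ Real.exp ‖w‖ := by
          have : Real.exp 2 ≤ Real.exp ‖w‖ := by gcongr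
          have h10 : Real.exp 2 = Real.exp 1 * Real.exp 1 := by rw [← Real.exp_add]; norm_num
          have := Real.exp_one_gt_d9
          nlinarith
        rw [inv_le_comm₀ (by positivity) (by norm_num)]
        norm_num; linarith
      linarith
    have hpi : Real.exp (-(2 * ‖w‖)) ≤ Real.exp (-((1 / 2 + w).re / 2 * Real.log Real.pi)) := by
      rw [Real.exp_le_exp, neg_le_neg_iff]
      have := Real.log_le_sub_one_of_pos Real.pi_pos
      have := Real.pi_lt_d2
      have h0 := Real.log_nonneg (show 1 ≤ Real.pi by linarith [Real.pi_gt_three])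
      rw [hre']
      have h2 : (1 / 2 + w.re) / 2 ≤ ‖w‖ * (2 / 3) := by linarith
      calc (1 / 2 + w.re) / 2 * Real.log Real.pi ≤ (‖w‖ * (2 / 3)) * 3 := by
            apply mul_le_mul h2 (by linarith) h0 (by positivity)
        _ = _ := by ring
    have hG : Real.exp (1 / 2 * w.re * Real.log ‖w‖ - (C + 2) * ‖w‖) ≤
        ‖Complex.Gamma ((1 / 2 + w) / 2)‖ := by
      have e3 : ((1 / 2 + w) / 2).re = (1 / 2 + w.re) / 2 := by simp
      refine le_trans ?_ (hC _ (by rw [e3]; linarith))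
      rw [Real.exp_le_exp]
      rw [e3]
      have h8 : ‖(1 / 2 + w) / 2‖ = ‖1 / 2 + w‖ / 2 := by rw [norm_div, Complex.norm_ofNat]
      have h9 : Real.log ‖w‖ - Real.log 2 ≤ Real.log ‖(1 / 2 + w) / 2‖ := by
        rw [h8, Real.log_div (by linarith) (by norm_num)]
        gcongr
      have h10 : C * ‖(1 / 2 + w) / 2‖ ≤ C * ‖w‖ := by
        gcongr
        rw [h8]; linarith
      have h11 : Real.log 2 ≤ 1 := by linarith [Real.log_two_lt_d9]
      have h12 : (1 / 2 + w.re) / 2 * (Real.log ‖w‖ - Real.log 2) ≤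
          (1 / 2 + w.re) / 2 * Real.log ‖(1 / 2 + w) / 2‖ := by gcongr
      have h13 := Real.log_nonneg (show (1 : ℝ) ≤ 2 by norm_num)
      have h14 : (1 / 2 + w.re) / 2 * Real.log 2 ≤ (1 / 2 + w.re) / 2 * 1 := by gcongr
      nlinarith
    calc _ = 1 * 1 * (Real.exp (-(2 * ‖w‖)) *
          Real.exp (1 / 2 * w.re * Real.log ‖w‖ - (C + 3) * ‖w‖) * Real.exp (-‖w‖)) := by
          rw [one_mul, one_mul, ← Real.exp_add, ← Real.exp_add]; ring_nf
      _ ≤ 1 * 1 * (Real.exp (-(2 * ‖w‖)) *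
          Real.exp (1 / 2 * w.re * Real.log ‖w‖ - (C + 2) * ‖w‖) * Real.exp (-‖w‖)) := by
          gcongr; linarith
      _ ≤ _ := by gcongr; linarith
  refine ⟨C + 6, by positivity, fun w hw hre => ?_⟩
  rcases le_total 0 w.re with h | h
  · rw [abs_of_nonneg h] at *; exact main w hw hre
  · rw [abs_of_nonpos h] at *
    have := main (-w) (by simpa using hw) (by simpa using hre)
    simpa [centeredXi_neg] using this

/-! ### The Poisson–Jensen inequality -/

theorem continuousOn_poissonKernel_sphere {a : ℂ} {R : ℝ} (ha : a ∈ Metric.ball (0 : ℂ) R) :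
    ContinuousOn (poissonKernel 0 a) (Metric.sphere 0 |R|) := by
  rw [poissonKernel_eq_re_herglotzRieszKernel]
  exact Complex.continuous_re.comp_continuousOn (continuousOn_herglotzRieszKernel_sphere ha)

theorem circleIntegrable_poissonKernel_mul {a : ℂ} {R : ℝ} (ha : a ∈ Metric.ball (0 : ℂ) R)
    {f : ℂ → ℝ} (hf : CircleIntegrable f 0 R) :
    CircleIntegrable (fun z => poissonKernel 0 a z * f z) 0 R := by
  refine IntervalIntegrable.continuousOn_mul hf ?_
  refine (continuousOn_poissonKernel_sphere ha).comp (continuous_circleMap 0 R).continuousOn ?_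
  intro θ _
  exact circleMap_mem_sphere' 0 R θ

theorem poissonKernel_nonneg {a z : ℂ} (h : ‖a‖ ≤ ‖z‖) : 0 ≤ poissonKernel 0 a z := by
  rw [poissonKernel_def]
  have : ‖a - 0‖ ^ 2 ≤ ‖z - 0‖ ^ 2 := by simpa using pow_le_pow_left₀ (norm_nonneg _) h 2
  exact div_nonneg (by linarith) (by positivity)

theorem circleAverage_poissonKernel {a : ℂ} {R : ℝ} (ha : a ∈ Metric.ball (0 : ℂ) R) :
    Real.circleAverage (poissonKernel 0 a) 0 R = 1 := by
  have h : InnerProductSpace.HarmonicOnNhd (fun _ : ℂ => (1 : ℝ)) (Metric.closedBall 0 R) :=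
    fun x _ => by simp
  have := h.circleAverage_poissonKernel_smul ha
  rw [← this]
  congr 1
  ext z
  simp

/-- On `|z| = R` the factor `z - u` has the same modulus as `h(z) = R - ū z / R`, which has no zero
in the disc when `|u| < R`. So the average equals `log |h(a)|`, and `|h(a)| ≥ |a - u|`. For `|u| =
R` there is equality. -/
theorem log_norm_sub_le_circleAverage_poissonKernel {a u : ℂ} {R : ℝ}
    (ha : a ∈ Metric.ball (0 : ℂ) R) (hu : u ∈ Metric.closedBall (0 : ℂ) R) (hau : a ≠ u) :
    Real.log ‖a - u‖ ≤
      Real.circleAverage (fun z => poissonKernel 0 a z * Real.log ‖z - u‖) 0 R := by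
  have hR : 0 < R := Metric.pos_of_mem_ball ha
  rcases eq_or_lt_of_le (mem_closedBall_zero_iff.1 hu) with hu | hu
  · have := circleAverage_re_herglotzRieszKernel_mul_log (ρ := u) (w := a) (c := 0) (R := R)
      (mem_sphere_zero_iff_norm.2 hu) ha
    rw [← this, ← poissonKernel_eq_re_herglotzRieszKernel]
    rfl
  · have ha' : ‖a‖ < R := mem_ball_zero_iff.1 ha
    have hRC : (R : ℂ) ≠ 0 := by exact_mod_cast hR.ne'
    let h (z : ℂ) : ℂ := R - (starRingEnd ℂ) u * z / R
    have hne : ∀ z ∈ Metric.closedBall (0 : ℂ) R, h z ≠ 0 := by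
      intro z hz h0
      have hz' := mem_closedBall_zero_iff.1 hz
      have h1 : (R : ℂ) = (starRingEnd ℂ) u * z / R := sub_eq_zero.1 h0
      have h2 := congrArg norm h1
      rw [norm_div, norm_mul, RCLike.norm_conj, Complex.norm_real, Real.norm_of_nonneg hR.le] at h2
      rw [eq_div_iff hR.ne'] at h2
      nlinarith [norm_nonneg u, norm_nonneg z]
    have hharm : InnerProductSpace.HarmonicOnNhd (fun z => Real.log ‖h z‖)
        (Metric.closedBall 0 R) :=
      fun z hz => AnalyticAt.harmonicAt_log_norm (by fun_prop) (hne z hz)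
    have hav := hharm.circleAverage_poissonKernel_smul ha
    have hcongr : Real.circleAverage (fun z => poissonKernel 0 a z * Real.log ‖z - u‖) 0 R =
        Real.circleAverage (poissonKernel 0 a • fun z => Real.log ‖h z‖) 0 R := by
      refine Real.circleAverage_congr_sphere fun z hz => ?_
      rw [abs_of_pos hR, mem_sphere_zero_iff_norm] at hz
      have e : ‖z - u‖ = ‖h z‖ := by
        have h3 : h z = z * (starRingEnd ℂ) (z - u) / R := by
          have h4 : z * (starRingEnd ℂ) z = R * R := by
            rw [Complex.mul_conj, Complex.normSq_eq_norm_sq, hz]; push_cast; ring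
          simp only [h, map_sub, mul_sub, h4]
          field_simp
        rw [h3, norm_div, norm_mul, RCLike.norm_conj, Complex.norm_real,
          Real.norm_of_nonneg hR.le, hz]
        field_simp
      simp [e]
    rw [hcongr, hav]
    have hpos : 0 < ‖a - u‖ := norm_pos_iff.2 (sub_ne_zero.2 hau)
    refine Real.log_le_log hpos ?_
    have h5 : ‖h a‖ = ‖(R : ℂ) ^ 2 - (starRingEnd ℂ) u * a‖ / R := by
      have : h a = ((R : ℂ) ^ 2 - (starRingEnd ℂ) u * a) / R := by
        simp only [h]; field_simp
      rw [this, norm_div, Complex.norm_real, Real.norm_of_nonneg hR.le]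
    rw [h5, le_div_iff₀ hR, ← sq_le_sq₀ (by positivity) (norm_nonneg _), mul_pow,
      ← Complex.normSq_eq_norm_sq, ← Complex.normSq_eq_norm_sq]
    have h6 : Complex.normSq a ≤ R ^ 2 := by
      rw [Complex.normSq_eq_norm_sq]; exact pow_le_pow_left₀ (norm_nonneg _) ha'.le 2
    have h7 : Complex.normSq u ≤ R ^ 2 := by
      rw [Complex.normSq_eq_norm_sq]; exact pow_le_pow_left₀ (norm_nonneg _) hu.le 2
    -- This identity is what makes a Blaschke factor at most `1` in modulus inside the disc.
    have h8 : Complex.normSq ((R : ℂ) ^ 2 - (starRingEnd ℂ) u * a) -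
        Complex.normSq (a - u) * R ^ 2 =
          (R ^ 2 - Complex.normSq a) * (R ^ 2 - Complex.normSq u) := by
      rw [← Complex.ofReal_pow]
      simp only [Complex.normSq_apply, Complex.sub_re, Complex.sub_im, Complex.mul_re,
        Complex.mul_im, Complex.ofReal_re, Complex.ofReal_im, Complex.conj_re, Complex.conj_im]
      ring
    nlinarith [mul_nonneg (sub_nonneg.2 h6) (sub_nonneg.2 h7)]

/-- Divide out the zeros: `f` is a finite product of factors `z - u` times a zero-free `g`.
Poisson's formula is exact for `log |g|`, and each linear factor obeys the inequality with a
nonnegative multiplicity. -/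
theorem log_norm_le_circleAverage_poissonKernel {f : ℂ → ℂ} {a : ℂ} {R : ℝ}
    (hf : AnalyticOnNhd ℂ f (Metric.closedBall 0 R)) (ha : a ∈ Metric.ball (0 : ℂ) R)
    (hfa : f a ≠ 0) :
    Real.log ‖f a‖ ≤
      Real.circleAverage (fun z => poissonKernel 0 a z * Real.log ‖f z‖) 0 R := by
  have hR : 0 < R := Metric.pos_of_mem_ball ha
  have haCB : a ∈ Metric.closedBall (0 : ℂ) R := Metric.ball_subset_closedBall ha
  set CB := Metric.closedBall (0 : ℂ) R with hCB
  have hm : MeromorphicOn f CB := hf.meromorphicOn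
  have hord : ∀ u : CB, meromorphicOrderAt f u ≠ ⊤ := by
    rw [← hm.exists_meromorphicOrderAt_ne_top_iff_forall
      ⟨⟨a, haCB⟩, (convex_closedBall 0 R).isPreconnected⟩]
    refine ⟨⟨a, haCB⟩, ?_⟩
    rw [(hf a haCB).meromorphicOrderAt_eq, (hf a haCB).analyticOrderAt_eq_zero.2 hfa]
    simp
  set D := MeromorphicOn.divisor f CB with hD
  have hfin := D.finiteSupport (isCompact_closedBall 0 R)
  obtain ⟨g, h₁g, h₂g, h₃g⟩ := hm.extract_zeros_poles hord hfin
  have hacc : AccPt a (𝓟 CB) := by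
    refine accPt_iff_frequently_nhdsNE.mpr (compl_notMem (mem_nhdsWithin.mpr ?_))
    exact ⟨Metric.ball 0 R, Metric.isOpen_ball, ha, fun z hz =>
      Metric.ball_subset_closedBall hz.1⟩
  have hval := MeromorphicOn.log_norm_meromorphicTrailingCoeffAt_extract_zeros_poles hfin haCB
    hacc (hf a haCB).meromorphicAt (h₁g a haCB) (h₂g ⟨a, haCB⟩) h₃g
  rw [(hf a haCB).meromorphicTrailingCoeffAt_of_ne_zero hfa] at hval
  have hlog := MeromorphicOn.extract_zeros_poles_log h₂g h₃g
  have hsub : Metric.sphere (0 : ℂ) |R| ⊆ CB := by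
    rw [abs_of_pos hR]; exact Metric.sphere_subset_closedBall
  have hsupp : (Function.support fun u => fun z : ℂ => (D u : ℝ) * Real.log ‖z - u‖) ⊆
      hfin.toFinset := by
    intro u hu
    simp only [Set.Finite.coe_toFinset, Function.mem_support] at hu ⊢
    intro h; apply hu; ext z; simp [h]
  have hsuppa : (Function.support fun u => (D u : ℝ) * Real.log ‖a - u‖) ⊆ hfin.toFinset := by
    intro u hu
    simp only [Set.Finite.coe_toFinset, Function.mem_support] at hu ⊢
    intro h; apply hu; simp [h]
  rw [finsum_eq_sum_of_support_subset _ hsupp] at hlog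
  rw [finsum_eq_sum_of_support_subset _ hsuppa] at hval
  -- The factorization holds only off a discrete set, which a circle average ignores.
  have hav : Real.circleAverage (fun z => poissonKernel 0 a z * Real.log ‖f z‖) 0 R =
      Real.circleAverage ((∑ u ∈ hfin.toFinset,
        fun z => (D u : ℝ) • (poissonKernel 0 a z * Real.log ‖z - u‖)) +
        fun z => poissonKernel 0 a z * Real.log ‖g z‖) 0 R := by
    refine Real.circleAverage_congr_codiscreteWithin ?_ hR.ne'
    filter_upwards [Filter.codiscreteWithin_mono hsub hlog] with z hz
    rw [hz]
    simp only [Pi.add_apply, Finset.sum_apply, mul_add, Finset.mul_sum, smul_eq_mul]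
    congr 1
    refine Finset.sum_congr rfl fun u _ => by ring
  have hint (u : ℂ) : CircleIntegrable
      (fun z => poissonKernel 0 a z * Real.log ‖z - u‖) 0 R :=
    circleIntegrable_poissonKernel_mul ha
      (analyticOnNhd_id.sub analyticOnNhd_const).meromorphicOn.circleIntegrable_log_norm
  have hintg : CircleIntegrable (fun z => poissonKernel 0 a z * Real.log ‖g z‖) 0 R :=
    circleIntegrable_poissonKernel_mul ha
      (h₁g.mono hsub).meromorphicOn.circleIntegrable_log_norm
  have hintD (u : ℂ) : CircleIntegrable
      (fun z => (D u : ℝ) • (poissonKernel 0 a z * Real.log ‖z - u‖)) 0 R :=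
    (hint u).const_smul
  rw [hav, Real.circleAverage_add (CircleIntegrable.sum _ fun u _ => hintD u) hintg,
    Real.circleAverage_sum fun u _ => hintD u, hval]
  have hg : Real.circleAverage (fun z => poissonKernel 0 a z * Real.log ‖g z‖) 0 R =
      Real.log ‖g a‖ := by
    have : InnerProductSpace.HarmonicOnNhd (fun z => Real.log ‖g z‖) (Metric.closedBall 0 R) :=
      fun z hz => (h₁g z hz).harmonicAt_log_norm (h₂g ⟨z, hz⟩)
    exact this.circleAverage_poissonKernel_smul ha
  rw [hg]
  gcongr with u hu
  rw [Real.circleAverage_fun_smul, smul_eq_mul]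
  have hDu : D u ≠ 0 := by simpa using hu
  have huCB : u ∈ CB := D.supportWithinDomain hDu
  have hau : a ≠ u := by
    rintro rfl
    apply hDu
    rw [hD, MeromorphicOn.divisor_apply hm haCB, (hf a haCB).meromorphicOrderAt_eq,
      (hf a haCB).analyticOrderAt_eq_zero.2 hfa]
    simp
  have hnn : (0 : ℝ) ≤ D u := by
    exact_mod_cast (MeromorphicOn.AnalyticOnNhd.divisor_nonneg hf) u
  gcongr
  exact log_norm_sub_le_circleAverage_poissonKernel ha huCB hau

/-! ### The circle averages of `log |ξ|` -/

theorem integral_abs_cos : ∫ θ in (0 : ℝ)..(2 * Real.pi), |Real.cos θ| = 4 := by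
  have hper : Function.Periodic (fun θ => |Real.cos θ|) (2 * Real.pi) := fun θ => by
    simp [Real.cos_add_two_pi]
  have h := hper.intervalIntegral_add_eq 0 (-(Real.pi / 2))
  rw [zero_add] at h
  have hcont : Continuous fun θ => |Real.cos θ| := Real.continuous_cos.abs
  have hpi := Real.pi_pos
  rw [h, ← intervalIntegral.integral_add_adjacent_intervals (b := Real.pi / 2)
    (hcont.intervalIntegrable _ _) (hcont.intervalIntegrable _ _)]
  have h1 : ∫ θ in (-(Real.pi / 2))..(Real.pi / 2), |Real.cos θ| = 2 := by
    rw [intervalIntegral.integral_congr (g := Real.cos)]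
    · simp; norm_num
    · intro θ hθ
      rw [Set.uIcc_of_le (by linarith)] at hθ
      exact abs_of_nonneg (Real.cos_nonneg_of_mem_Icc hθ)
  have h2 : ∫ θ in (Real.pi / 2)..(-(Real.pi / 2) + 2 * Real.pi), |Real.cos θ| = 2 := by
    rw [intervalIntegral.integral_congr (g := fun θ => -Real.cos θ)]
    · rw [intervalIntegral.integral_neg, integral_cos]
      rw [show -(Real.pi / 2) + 2 * Real.pi = Real.pi / 2 + Real.pi by ring, Real.sin_add_pi]
      simp; norm_num
    · intro θ hθ
      rw [Set.uIcc_of_le (by linarith)] at hθ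
      exact abs_of_nonpos (Real.cos_nonpos_of_pi_div_two_le_of_le hθ.1 (by linarith [hθ.2]))
  rw [h1, h2]; norm_num

theorem circleAverage_abs_re {R : ℝ} (hR : 0 ≤ R) :
    Real.circleAverage (fun z => |z.re|) 0 R = 2 * R / Real.pi := by
  rw [Real.circleAverage_def]
  have : ∀ θ : ℝ, |(circleMap 0 R θ).re| = R * |Real.cos θ| := fun θ => by
    rw [circleMap_zero, Complex.re_ofReal_mul, Complex.exp_ofReal_mul_I_re, abs_mul,
      abs_of_nonneg hR]
  simp only [this]
  rw [intervalIntegral.integral_const_mul, integral_abs_cos]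
  have := Real.pi_pos
  simp only [smul_eq_mul]
  field_simp
  ring

theorem circleIntegrable_abs_re (R : ℝ) : CircleIntegrable (fun z => |z.re|) 0 R :=
  (Complex.continuous_re.abs).continuousOn.circleIntegrable'

/-- The mean of `log |ξ|` over the circle of radius `R` around the point `1 / 2`. -/
noncomputable def meanLogXi (R : ℝ) : ℝ :=
  Real.circleAverage (fun z => Real.log ‖centeredXi z‖) 0 R

theorem circleIntegrable_log_centeredXi (R : ℝ) :
    CircleIntegrable (fun z => Real.log ‖centeredXi z‖) 0 R :=
  MeromorphicOn.circleIntegrable_log_norm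
    fun z _ => (differentiable_centeredXi.analyticAt z).meromorphicAt

theorem circleIntegrable_posLog_centeredXi (R : ℝ) :
    CircleIntegrable (fun z => Real.posLog ‖centeredXi z‖) 0 R :=
  MeromorphicOn.circleIntegrable_posLog_norm
    fun z _ => (differentiable_centeredXi.analyticAt z).meromorphicAt

theorem posLog_centeredXi_le {C : ℝ} (hC0 : 0 ≤ C) (hC : ∀ w : ℂ, 2 ≤ ‖w‖ →
    ‖centeredXi w‖ ≤ Real.exp (1 / 2 * |w.re| * Real.log ‖w‖ + C * ‖w‖)) {w : ℂ} (hw : 2 ≤ ‖w‖) :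
    Real.posLog ‖centeredXi w‖ ≤ 1 / 2 * |w.re| * Real.log ‖w‖ + C * ‖w‖ := by
  have hlog : 0 ≤ Real.log ‖w‖ := Real.log_nonneg (by linarith)
  rw [Real.posLog_def]
  refine max_le (by positivity) ?_
  rcases (norm_nonneg (centeredXi w)).eq_or_lt with h | h
  -- At a zero of `ξ` the convention `log 0 = 0` leaves only nonnegativity of the bound to check.
  · rw [← h]; simp only [Real.log_zero]; positivity
  · exact (Real.log_le_iff_le_exp h).2 (hC w hw)

theorem exists_meanLogXi_le : ∃ C : ℝ, ∀ R : ℝ, 2 ≤ R →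
    meanLogXi R ≤ R * Real.log R / Real.pi + C * R := by
  obtain ⟨C, hC0, hC⟩ := exists_norm_centeredXi_le
  refine ⟨C, fun R hR => ?_⟩
  have h1 : meanLogXi R ≤ Real.circleAverage
      (((1 / 2 * Real.log R) • fun z : ℂ => |z.re|) + fun _ => C * R) 0 R := by
    refine Real.circleAverage_mono (circleIntegrable_log_centeredXi R)
      ((circleIntegrable_abs_re R).const_smul.add (circleIntegrable_const _ _ _)) fun z hz => ?_
    rw [abs_of_pos (by linarith), mem_sphere_zero_iff_norm] at hz
    have := posLog_centeredXi_le hC0 hC (w := z) (by rw [hz]; exact hR)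
    have h2 := (le_max_right 0 (Real.log ‖centeredXi z‖)).trans this
    rw [hz] at h2
    simp only [Pi.add_apply, Pi.smul_apply, smul_eq_mul]
    linarith
  rw [Real.circleAverage_add (circleIntegrable_abs_re R).const_smul (circleIntegrable_const _ _ _),
    Real.circleAverage_smul, circleAverage_abs_re (by linarith),
    Real.circleAverage_const] at h1
  refine h1.trans (le_of_eq ?_)
  simp only [smul_eq_mul]
  ring

/-- By Poisson–Jensen the weighted mean of `log |ξ|` is at least `log |ξ(a)| ≥ -C R`. The positive
part has weighted mean at most `R log R / 2 + C R`, so the negative part cannot be large. -/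
theorem circleAverage_poissonKernel_mul_negPart_le {C R : ℝ} (hC0 : 0 ≤ C)
    (hup : ∀ w : ℂ, 2 ≤ ‖w‖ →
      ‖centeredXi w‖ ≤ Real.exp (1 / 2 * |w.re| * Real.log ‖w‖ + C * ‖w‖))
    (hlow : ∀ w : ℂ, 2 ≤ ‖w‖ → 3 / 2 ≤ |w.re| →
      Real.exp (1 / 2 * |w.re| * Real.log ‖w‖ - C * ‖w‖) ≤ ‖centeredXi w‖)
    {a : ℂ} (ha : ‖a‖ < R) (ha2 : 2 ≤ ‖a‖) (hare : 3 / 2 ≤ |a.re|) :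
    Real.circleAverage (fun z => poissonKernel 0 a z *
      (Real.posLog ‖centeredXi z‖ - Real.log ‖centeredXi z‖)) 0 R ≤
      1 / 2 * R * Real.log R + 2 * C * R := by
  have hball : a ∈ Metric.ball (0 : ℂ) R := by simpa using ha
  have hR : 2 ≤ R := by linarith
  have hlog : 0 ≤ Real.log R := Real.log_nonneg (by linarith)
  have hla : -(C * R) ≤ Real.log ‖centeredXi a‖ := by
    have h1 := hlow a ha2 hare
    have h2 := Real.log_le_log (Real.exp_pos _) h1
    rw [Real.log_exp] at h2
    have : 0 ≤ 1 / 2 * |a.re| * Real.log ‖a‖ := by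
      have := Real.log_nonneg (show 1 ≤ ‖a‖ by linarith)
      positivity
    have : C * ‖a‖ ≤ C * R := by gcongr
    linarith
  have hne : centeredXi a ≠ 0 := by
    rw [← norm_pos_iff]
    exact (Real.exp_pos _).trans_le (hlow a ha2 hare)
  have hPJ := log_norm_le_circleAverage_poissonKernel (R := R)
    (fun z _ => differentiable_centeredXi.analyticAt z) hball hne
  have hi1 := circleIntegrable_poissonKernel_mul hball (circleIntegrable_posLog_centeredXi R)
  have hi2 := circleIntegrable_poissonKernel_mul hball (circleIntegrable_log_centeredXi R)
  have hsplit : (fun z => poissonKernel 0 a z *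
      (Real.posLog ‖centeredXi z‖ - Real.log ‖centeredXi z‖)) =
      (fun z => poissonKernel 0 a z * Real.posLog ‖centeredXi z‖) -
      fun z => poissonKernel 0 a z * Real.log ‖centeredXi z‖ := by
    ext z; simp [mul_sub]
  rw [hsplit, Real.circleAverage_sub hi1 hi2]
  have hone : CircleIntegrable (poissonKernel 0 a) 0 R := by
    have := circleIntegrable_poissonKernel_mul hball (circleIntegrable_const (1 : ℝ) 0 R)
    simpa using this
  have hpos : Real.circleAverage (fun z => poissonKernel 0 a z * Real.posLog ‖centeredXi z‖) 0 R ≤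
      1 / 2 * R * Real.log R + C * R := by
    calc _ ≤ Real.circleAverage
          (fun z => (1 / 2 * R * Real.log R + C * R) • poissonKernel 0 a z) 0 R := by
          refine Real.circleAverage_mono hi1 hone.const_smul fun z hz => ?_
          rw [abs_of_pos (by linarith), mem_sphere_zero_iff_norm] at hz
          have h1 := posLog_centeredXi_le hC0 hup (w := z) (by rw [hz]; exact hR)
          have h2 := Complex.abs_re_le_norm z
          rw [hz] at h1 h2
          have h3 := poissonKernel_nonneg (a := a) (z := z) (by rw [hz]; exact ha.le)
          rw [smul_eq_mul, mul_comm]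
          gcongr
          refine h1.trans ?_
          gcongr
      _ = _ := by
          rw [Real.circleAverage_fun_smul, circleAverage_poissonKernel hball, smul_eq_mul, mul_one]
  linarith

/-- The base point is at distance at most `√2 η R` from the upper cap of the circle while `R² - |a|²
≥ η R² / 2`, so the kernel is at least `1 / (4η)` there. -/
theorem one_le_mul_poissonKernel {η R : ℝ} (hη0 : 0 < η) (hη1 : η ≤ 1) (hR : 4 ≤ η * R) {z : ℂ}
    (hz : ‖z‖ = R) (hre : |z.re| ≤ 3 / 2) (him : 0 ≤ z.im) :
    1 ≤ 4 * η * poissonKernel 0 (⟨2, (1 - η) * R⟩ : ℂ) z := by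
  have hR4 : 4 ≤ R := by nlinarith
  have hzsq : z.re ^ 2 + z.im ^ 2 = R ^ 2 := by
    rw [← hz, ← Complex.normSq_eq_norm_sq, Complex.normSq_apply]; ring
  obtain ⟨hre1, hre2⟩ := abs_le.1 hre
  have him1 : R - 1 ≤ z.im := by
    by_contra! h
    nlinarith
  have him2 : z.im ≤ R := by rw [← hz]; exact (le_abs_self _).trans (Complex.abs_im_le_norm z)
  rw [poissonKernel_def, sub_zero, sub_zero, hz, ← Complex.normSq_eq_norm_sq,
    ← Complex.normSq_eq_norm_sq, Complex.normSq_apply, Complex.normSq_apply]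
  simp only [Complex.sub_re, Complex.sub_im]
  have hd0 : 0 ≤ z.im - (1 - η) * R := by nlinarith
  have hd1 : z.im - (1 - η) * R ≤ η * R := by nlinarith
  have hden : (z.re - 2) * (z.re - 2) + (z.im - (1 - η) * R) * (z.im - (1 - η) * R) ≤
      2 * (η * R) ^ 2 := by nlinarith
  have hnum : η * R ^ 2 / 2 ≤ R ^ 2 - (2 * 2 + (1 - η) * R * ((1 - η) * R)) := by
    have h1 : 0 ≤ η * (1 - η) * R ^ 2 := by
      have : 0 ≤ 1 - η := by linarith
      positivity
    have h2 : 16 ≤ η * R * R := by nlinarith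
    nlinarith
  have hdpos : 0 < (z.re - 2) * (z.re - 2) + (z.im - (1 - η) * R) * (z.im - (1 - η) * R) := by
    nlinarith [sq_nonneg (z.im - (1 - η) * R)]
  rw [mul_div_assoc', le_div_iff₀ hdpos, one_mul]
  refine hden.trans ?_
  nlinarith

/-- Off the strip the pointwise bound holds. On each of the two caps inside it the negative part of
`log |ξ|` is dominated by `4η` times its Poisson-weighted version, so each cap costs at most about
`2η R log R`. -/
theorem exists_le_meanLogXi : ∃ C : ℝ, 0 ≤ C ∧ ∀ η R : ℝ, 0 < η → η ≤ 1 → 4 ≤ η * R →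
    R * Real.log R / Real.pi - 4 * η * (R * Real.log R) - C * R ≤ meanLogXi R := by
  obtain ⟨C₁, hC₁0, hC₁⟩ := exists_norm_centeredXi_le
  obtain ⟨C₂, hC₂0, hC₂⟩ := exists_exp_le_norm_centeredXi
  -- The extra `1` ensures `C ≥ 1`, so that `C R` absorbs the main term `|Re z| log R / 2 ≤ 3R/4`
  -- inside the strip.
  set C := C₁ + C₂ + 1 with hCdef
  have hC0 : 0 ≤ C := by positivity
  have hup : ∀ w : ℂ, 2 ≤ ‖w‖ →
      ‖centeredXi w‖ ≤ Real.exp (1 / 2 * |w.re| * Real.log ‖w‖ + C * ‖w‖) := fun w hw =>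
    (hC₁ w hw).trans (by gcongr; linarith)
  have hlow : ∀ w : ℂ, 2 ≤ ‖w‖ → 3 / 2 ≤ |w.re| →
      Real.exp (1 / 2 * |w.re| * Real.log ‖w‖ - C * ‖w‖) ≤ ‖centeredXi w‖ := fun w hw hre =>
    le_trans (by gcongr; linarith) (hC₂ w hw hre)
  refine ⟨17 * C, by positivity, fun η R hη0 hη1 hηR => ?_⟩
  have hR4 : 4 ≤ R := by nlinarith
  have hlogR : 0 ≤ Real.log R := Real.log_nonneg (by linarith)
  have hlogR' : Real.log R ≤ R := by
    have := Real.log_le_sub_one_of_pos (show 0 < R by linarith); linarith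
  set a : ℂ := ⟨2, (1 - η) * R⟩ with ha
  have haR : ‖a‖ < R := by
    rw [← sq_lt_sq₀ (norm_nonneg _) (by linarith), ← Complex.normSq_eq_norm_sq,
      Complex.normSq_apply]
    simp only [ha]
    have h1 : 0 ≤ η * (1 - η) * R ^ 2 := by
      have : 0 ≤ 1 - η := by linarith
      positivity
    have h2 : 16 ≤ η * R * R := by nlinarith
    nlinarith
  have ha2 : 2 ≤ ‖a‖ := by
    have := Complex.re_le_norm a
    simpa [ha] using this
  have hare : 3 / 2 ≤ |a.re| := by simp [ha]; norm_num
  have hball : a ∈ Metric.ball (0 : ℂ) R := by simpa using haR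
  have hball' : -a ∈ Metric.ball (0 : ℂ) R := by simpa using haR
  have hneg1 := circleAverage_poissonKernel_mul_negPart_le hC0 hup hlow haR ha2 hare
  have hneg2 := circleAverage_poissonKernel_mul_negPart_le hC0 hup hlow (a := -a) (R := R)
    (by simpa using haR) (by simpa using ha2) (by simpa using hare)
  set v : ℂ → ℝ := fun z => Real.posLog ‖centeredXi z‖ - Real.log ‖centeredXi z‖ with hv
  have hvint : CircleIntegrable v 0 R :=
    (circleIntegrable_posLog_centeredXi R).sub (circleIntegrable_log_centeredXi R)
  have hv0 (z : ℂ) : 0 ≤ v z := sub_nonneg.2 (le_max_right _ _)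
  have hvlog (z : ℂ) : -v z ≤ Real.log ‖centeredXi z‖ := by
    have : 0 ≤ Real.posLog ‖centeredXi z‖ := Real.posLog_nonneg
    simp only [hv]; linarith
  have hint1 := circleIntegrable_poissonKernel_mul hball hvint
  have hint2 := circleIntegrable_poissonKernel_mul hball' hvint
  have hlower : Real.circleAverage
      (((((1 / 2 * Real.log R) • fun z : ℂ => |z.re|) - fun _ => C * R) -
        (4 * η) • fun z => (poissonKernel 0 a z * v z)) -
        (4 * η) • fun z => (poissonKernel 0 (-a) z * v z)) 0 R ≤ meanLogXi R := by
    refine Real.circleAverage_mono ((((circleIntegrable_abs_re R).const_smul.sub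
      (circleIntegrable_const _ _ _)).sub hint1.const_smul).sub hint2.const_smul)
      (circleIntegrable_log_centeredXi R) fun z hz => ?_
    rw [abs_of_pos (by linarith), mem_sphere_zero_iff_norm] at hz
    simp only [Pi.sub_apply, Pi.smul_apply, smul_eq_mul]
    have hP1 := poissonKernel_nonneg (a := a) (z := z) (by rw [hz]; exact haR.le)
    have hP2 := poissonKernel_nonneg (a := -a) (z := z) (by rw [hz, norm_neg]; exact haR.le)
    have hV1 : 0 ≤ 4 * η * (poissonKernel 0 a z * v z) :=
      mul_nonneg (by positivity) (mul_nonneg hP1 (hv0 z))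
    have hV2 : 0 ≤ 4 * η * (poissonKernel 0 (-a) z * v z) :=
      mul_nonneg (by positivity) (mul_nonneg hP2 (hv0 z))
    by_cases hre : 3 / 2 ≤ |z.re|
    · have h1 := hlow z (by rw [hz]; linarith) hre
      have h2 := Real.log_le_log (Real.exp_pos _) h1
      rw [Real.log_exp, hz] at h2
      linarith
    · push Not at hre
      have h3 : 1 / 2 * Real.log R * |z.re| ≤ C * R := by
        calc _ ≤ 1 / 2 * R * (3 / 2) := by gcongr
          _ ≤ 1 * R := by linarith
          _ ≤ C * R := by gcongr; linarith
      have h4 := hvlog z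
      rcases le_total 0 z.im with him | him
      · have h5 := one_le_mul_poissonKernel hη0 hη1 hηR hz hre.le him
        have h6 : v z ≤ 4 * η * (poissonKernel 0 a z * v z) := by
          rw [← mul_assoc]
          exact le_mul_of_one_le_left (hv0 z) h5
        linarith
      -- The lower cap is the image of the upper one under `z ↦ -z`, with base point `-a`.
      · have h5 := one_le_mul_poissonKernel hη0 hη1 hηR (z := -z) (by rw [norm_neg, hz])
          (by simpa using hre.le) (by simpa using him)
        have h7 : poissonKernel 0 a (-z) = poissonKernel 0 (-a) z := by
          rw [poissonKernel_def, poissonKernel_def]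
          have : -z - 0 - (a - 0) = -(z - 0 - (-a - 0)) := by ring
          rw [this, norm_neg]
          simp
        rw [h7] at h5
        have h6 : v z ≤ 4 * η * (poissonKernel 0 (-a) z * v z) := by
          rw [← mul_assoc]
          exact le_mul_of_one_le_left (hv0 z) h5
        linarith
  rw [Real.circleAverage_sub (((circleIntegrable_abs_re R).const_smul.sub
      (circleIntegrable_const _ _ _)).sub hint1.const_smul) hint2.const_smul,
    Real.circleAverage_sub ((circleIntegrable_abs_re R).const_smul.sub
      (circleIntegrable_const _ _ _)) hint1.const_smul,
    Real.circleAverage_sub (circleIntegrable_abs_re R).const_smul (circleIntegrable_const _ _ _),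
    Real.circleAverage_smul, Real.circleAverage_smul, Real.circleAverage_smul,
    Real.circleAverage_const, circleAverage_abs_re (by linarith)] at hlower
  simp only [smul_eq_mul] at hlower
  refine le_trans ?_ hlower
  have h8 : 4 * η * Real.circleAverage (fun z => poissonKernel 0 a z * v z) 0 R ≤
      4 * η * (1 / 2 * R * Real.log R + 2 * C * R) := by gcongr
  have h9 : 4 * η * Real.circleAverage (fun z => poissonKernel 0 (-a) z * v z) 0 R ≤
      4 * η * (1 / 2 * R * Real.log R + 2 * C * R) := by gcongr
  have h10 : η * (C * R) ≤ 1 * (C * R) := by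
    gcongr
  have h11 : 1 / 2 * Real.log R * (2 * R / Real.pi) = R * Real.log R / Real.pi := by ring
  rw [h11]
  nlinarith

/-! ### A lower bound for the number of zeros -/

theorem analyticOrderAt_centeredXi (u : ℂ) :
    analyticOrderAt centeredXi u = analyticOrderAt xi (1 / 2 + u) := by
  have h := analyticOrderAt_comp_of_deriv_ne_zero (f := xi) (g := fun w : ℂ => 1 / 2 + w) (z₀ := u)
    (by fun_prop) (by simp)
  exact h

theorem analyticOrderAt_centeredXi_neg (u : ℂ) :
    analyticOrderAt centeredXi (-u) = analyticOrderAt centeredXi u := by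
  have h := analyticOrderAt_comp_of_deriv_ne_zero (f := centeredXi) (g := fun w : ℂ => -w) (z₀ := u)
    (by fun_prop) (by simp)
  rw [← h]
  congr 1
  ext w
  simp [centeredXi_neg]

theorem analyticOrderAt_centeredXi_ne_top (u : ℂ) : analyticOrderAt centeredXi u ≠ ⊤ := by
  have hA : AnalyticOnNhd ℂ centeredXi Set.univ :=
    fun z _ => differentiable_centeredXi.analyticAt z
  refine hA.analyticOrderAt_ne_top_of_isPreconnected isPreconnected_univ
    (x := 1 / 2) (Set.mem_univ _) (Set.mem_univ _) ?_
  rw [(hA _ (Set.mem_univ _)).analyticOrderAt_eq_zero.2]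
  · simp
  · rw [centeredXi]
    exact xi_ne_zero_of_one_le_re (by norm_num)

theorem re_mem_Ioo_of_centeredXi_eq_zero {u : ℂ} (h : centeredXi u = 0) :
    0 < (1 / 2 + u).re ∧ (1 / 2 + u).re < 1 :=
  re_mem_Ioo_of_xi_eq_zero h

theorem riemannZeta_eq_zero_of_centeredXi_eq_zero {u : ℂ} (h : centeredXi u = 0) :
    riemannZeta (1 / 2 + u) = 0 := by
  obtain ⟨h1, h2⟩ := re_mem_Ioo_of_centeredXi_eq_zero h
  have hs0 : (1 / 2 + u) ≠ 0 := by intro h; rw [h] at h1; simp at h1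
  have hs1 : (1 / 2 + u) ≠ 1 := by intro h; rw [h] at h2; simp at h2
  rw [centeredXi, xi_eq_mul_riemannZeta h1 hs1] at h
  have h3 := mul_ne_zero hs0 (sub_ne_zero.2 hs1)
  have h4 := Complex.Gammaℝ_ne_zero_of_re_pos h1
  exact (mul_eq_zero.1 ((mul_eq_zero.1 h).resolve_left h3)).resolve_left h4

theorem finite_centeredXi_zeros (R : ℝ) : {u : ℂ | centeredXi u = 0 ∧ ‖u‖ ≤ R}.Finite := by
  have hK : IsCompact (Metric.closedBall (1 / 2 : ℂ) R) := isCompact_closedBall _ _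
  refine (hK.inter_riemannZetaZeros_finite.preimage
    (f := fun u : ℂ => 1 / 2 + u) (add_right_injective _).injOn).subset ?_
  rintro u ⟨h0, hu⟩
  refine ⟨?_, riemannZeta_eq_zero_of_centeredXi_eq_zero h0⟩
  simpa [Complex.dist_eq] using hu

/-- The zeros of the centred `ξ` in the closed disc of radius `R`. -/
noncomputable def centeredXiZeros (R : ℝ) : Finset ℂ := (finite_centeredXi_zeros R).toFinset

theorem mem_centeredXiZeros {R : ℝ} {u : ℂ} :
    u ∈ centeredXiZeros R ↔ centeredXi u = 0 ∧ ‖u‖ ≤ R := by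
  simp [centeredXiZeros]

/-- Jensen's formula for an entire function: the divisor consists of zeros only, and the constant
comes from the leading coefficient at the centre. -/
theorem exists_meanLogXi_eq : ∃ c : ℝ, ∀ R : ℝ, 0 < R → meanLogXi R =
    ∑ u ∈ centeredXiZeros R,
      (analyticOrderNatAt centeredXi u : ℝ) * (Real.log R - Real.log ‖u‖) + c := by
  refine ⟨Real.log ‖meromorphicTrailingCoeffAt centeredXi 0‖, fun R hR => ?_⟩
  have hA : AnalyticOnNhd ℂ centeredXi (Metric.closedBall 0 |R|) :=
    fun z _ => differentiable_centeredXi.analyticAt z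
  have hdiv (u : ℂ) : MeromorphicOn.divisor centeredXi (Metric.closedBall 0 |R|) u =
      if u ∈ centeredXiZeros R then (analyticOrderNatAt centeredXi u : ℤ) else 0 := by
    by_cases hu : u ∈ Metric.closedBall (0 : ℂ) |R|
    · rw [MeromorphicOn.AnalyticOnNhd.divisor_apply hA hu,
        ← Nat.cast_analyticOrderNatAt (analyticOrderAt_centeredXi_ne_top u)]
      have hu' : ‖u‖ ≤ R := by simpa [abs_of_pos hR] using hu
      split_ifs with h
      · simp
      · rw [mem_centeredXiZeros] at h
        have h0 : centeredXi u ≠ 0 := fun h0 => h ⟨h0, hu'⟩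
        rw [analyticOrderNatAt, (hA u hu).analyticOrderAt_eq_zero.2 h0]
        simp
    · rw [Function.locallyFinsuppWithin.apply_eq_zero_of_notMem _ hu, if_neg]
      rw [mem_centeredXiZeros]
      intro h
      apply hu
      simpa [abs_of_pos hR] using h.2
  have hfin := (MeromorphicOn.divisor centeredXi (Metric.closedBall 0 |R|)).finiteSupport
    (isCompact_closedBall 0 |R|)
  rw [meanLogXi, hA.meromorphicOn.circleAverage_log_norm hR.ne']
  -- Because `log 0 = 0`, a possible zero at the centre contributes its multiplicity times `log R`
  -- within the same sum.
  rw [← countingFunction_finsum_eq_finsum_add hR.ne' hfin]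
  congr 1
  rw [finsum_eq_sum_of_support_subset (s := centeredXiZeros R)]
  · refine Finset.sum_congr rfl fun u hu => ?_
    rw [hdiv, if_pos hu]
    simp
  · intro u hu
    by_contra h
    apply hu
    simp only [SetLike.mem_coe] at h
    simp [hdiv, h]

/-- When the radius grows from `r` to `R`, a zero in the smaller disc gains exactly `log (R / r)` in
Jensen's formula, and a zero between the circles gains at most that. -/
theorem meanLogXi_sub_le {r R : ℝ} (hr : 0 < r) (hrR : r ≤ R) : meanLogXi R - meanLogXi r ≤
    (∑ u ∈ centeredXiZeros R, (analyticOrderNatAt centeredXi u : ℝ)) *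
      (Real.log R - Real.log r) := by
  obtain ⟨c, hc⟩ := exists_meanLogXi_eq
  rw [hc R (hr.trans_le hrR), hc r hr, Finset.sum_mul]
  have hsub : centeredXiZeros r ⊆ centeredXiZeros R := fun u hu => by
    rw [mem_centeredXiZeros] at *
    exact ⟨hu.1, hu.2.trans hrR⟩
  have hlog : Real.log r ≤ Real.log R := Real.log_le_log hr hrR
  rw [← Finset.sum_sdiff hsub, ← Finset.sum_sdiff hsub]
  have h1 : ∑ u ∈ centeredXiZeros R \ centeredXiZeros r,
      (analyticOrderNatAt centeredXi u : ℝ) * (Real.log R - Real.log ‖u‖) ≤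
      ∑ u ∈ centeredXiZeros R \ centeredXiZeros r,
      (analyticOrderNatAt centeredXi u : ℝ) * (Real.log R - Real.log r) := by
    refine Finset.sum_le_sum fun u hu => ?_
    rw [Finset.mem_sdiff, mem_centeredXiZeros, mem_centeredXiZeros] at hu
    have : r < ‖u‖ := by
      by_contra! h
      exact hu.2 ⟨hu.1.1, h⟩
    gcongr
  have h2 : ∑ u ∈ centeredXiZeros r,
      (analyticOrderNatAt centeredXi u : ℝ) * (Real.log R - Real.log ‖u‖) =
      ∑ u ∈ centeredXiZeros r,
      (analyticOrderNatAt centeredXi u : ℝ) * (Real.log R - Real.log r) +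
      ∑ u ∈ centeredXiZeros r,
      (analyticOrderNatAt centeredXi u : ℝ) * (Real.log r - Real.log ‖u‖) := by
    rw [← Finset.sum_add_distrib]
    exact Finset.sum_congr rfl fun u _ => by ring
  linarith

/-- The number of non-trivial zeros with `0 < γ ≤ T`, counted with multiplicity. -/
noncomputable def zeroCount (T : ℝ) : ℕ := ∑ ρ ∈ zeros T, mult ρ

theorem mem_zeros {T : ℝ} {ρ : ℂ} :
    ρ ∈ zeros T ↔ riemannZeta ρ = 0 ∧ 0 < ρ.re ∧ ρ.re < 1 ∧ 0 < ρ.im ∧ ρ.im ≤ T := by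
  simp [zeros, zeroSet]

/-- Zeros above the real axis come from zeros of `ζ` up to height `R`; those below are their images
under `u ↦ -u`; real ones lie in `(-1/2, 1/2)`, so their contribution is bounded independently of
`R`. -/
theorem sum_analyticOrderNatAt_centeredXi_le {R : ℝ} :
    ∑ u ∈ centeredXiZeros R, analyticOrderNatAt centeredXi u ≤
      2 * zeroCount R + ∑ u ∈ centeredXiZeros 1, analyticOrderNatAt centeredXi u := by
  classical
  set m := analyticOrderNatAt centeredXi with hm
  have hup : ∑ u ∈ centeredXiZeros R with 0 < u.im, m u ≤ zeroCount R := by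
    rw [zeroCount]
    refine (Finset.sum_le_sum_of_subset (t := (zeros R).image fun ρ => ρ - 1 / 2) ?_).trans ?_
    · intro u hu
      rw [Finset.mem_filter, mem_centeredXiZeros] at hu
      obtain ⟨⟨h0, hR⟩, him⟩ := hu
      rw [Finset.mem_image]
      refine ⟨1 / 2 + u, mem_zeros.2 ⟨riemannZeta_eq_zero_of_centeredXi_eq_zero h0,
        (re_mem_Ioo_of_centeredXi_eq_zero h0).1, (re_mem_Ioo_of_centeredXi_eq_zero h0).2,
        by simpa using him, ?_⟩, by ring⟩
      have := Complex.im_le_norm u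
      simp
      linarith
    · rw [Finset.sum_image (sub_left_injective.injOn)]
      refine Finset.sum_le_sum fun ρ hρ => ?_
      have hρ' := mem_zeros.1 hρ
      simp only [hm, mult, analyticOrderNatAt]
      rw [analyticOrderAt_centeredXi, add_sub_cancel, analyticOrderAt_xi hρ'.2.1 hρ'.2.2.1]
  have hdown : ∑ u ∈ centeredXiZeros R with u.im < 0, m u =
      ∑ u ∈ centeredXiZeros R with 0 < u.im, m u := by
    refine Finset.sum_nbij' (fun u => -u) (fun u => -u) ?_ ?_ ?_ ?_ ?_
    · intro u hu
      simpa [mem_centeredXiZeros, centeredXi_neg] using hu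
    · intro u hu
      simpa [mem_centeredXiZeros, centeredXi_neg] using hu
    · simp
    · simp
    · intro u _
      simp only [hm, analyticOrderNatAt, analyticOrderAt_centeredXi_neg]
  have hreal : ∑ u ∈ centeredXiZeros R with u.im = 0, m u ≤ ∑ u ∈ centeredXiZeros 1, m u := by
    refine Finset.sum_le_sum_of_subset fun u hu => ?_
    rw [Finset.mem_filter, mem_centeredXiZeros] at hu
    obtain ⟨⟨h0, -⟩, him⟩ := hu
    refine mem_centeredXiZeros.2 ⟨h0, ?_⟩
    obtain ⟨h1, h2⟩ := re_mem_Ioo_of_centeredXi_eq_zero h0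
    simp at h1 h2
    have := Complex.norm_le_abs_re_add_abs_im u
    rw [him, abs_zero, add_zero] at this
    refine this.trans (abs_le.2 ⟨by linarith, by linarith⟩)
  have hsplit : ∑ u ∈ centeredXiZeros R, m u = ∑ u ∈ centeredXiZeros R with 0 < u.im, m u +
      (∑ u ∈ centeredXiZeros R with u.im < 0, m u +
        ∑ u ∈ centeredXiZeros R with u.im = 0, m u) := by
    rw [← Finset.sum_filter_add_sum_filter_not (centeredXiZeros R) (fun u => 0 < u.im)]
    congr 1
    rw [← Finset.sum_filter_add_sum_filter_not _ (fun u : ℂ => u.im < 0), Finset.filter_filter,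
      Finset.filter_filter]
    congr 2
    · ext u
      simp only [Finset.mem_filter]
      constructor
      · rintro ⟨a, b, c⟩; exact ⟨a, c⟩
      · rintro ⟨a, b⟩; exact ⟨a, by linarith, b⟩
    · ext u
      simp only [Finset.mem_filter, not_lt]
      constructor
      · rintro ⟨a, b, c⟩; exact ⟨a, le_antisymm b c⟩
      · rintro ⟨a, b⟩; exact ⟨a, b.le, b.ge⟩
  omega

-- The means at `T` and `T / (1 + δ)` differ by about `δ T log T / π`, and by at most `n δ`, where
-- `n` counts the zeros of `ξ` in the disc. Half of `n`, up to a constant, is the count above the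
-- real axis.
set_option maxHeartbeats 1000000 in
theorem eventually_mul_le_zeroCount {ε : ℝ} (hε : 0 < ε) (hε1 : ε < 1) :
    ∀ᶠ T : ℝ in atTop, (1 - ε) * (T * L T) ≤ zeroCount T := by
  obtain ⟨C₁, hC₁⟩ := exists_meanLogXi_le
  obtain ⟨C₂, hC₂0, hC₂⟩ := exists_le_meanLogXi
  set C₀ : ℝ := ((∑ u ∈ centeredXiZeros 1, analyticOrderNatAt centeredXi u : ℕ) : ℝ) with hC₀
  set δ := ε / 2 with hδ
  have hδ0 : 0 < δ := by positivity
  -- The errors in the two means total `2 ε₁ X`; after division by `δ` they become `δ X / 30`, well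
  -- below the gain `δ X / π` from using `δ = ε / 2` in place of `ε`.
  set ε₁ := δ ^ 2 / 60 with hε₁
  have hε₁0 : 0 < ε₁ := by positivity
  have hε₁1 : ε₁ / 4 ≤ 1 := by
    have : δ ≤ 1 := by linarith
    rw [hε₁]; nlinarith
  have hη : 0 < ε₁ / 4 := by positivity
  filter_upwards [eventually_ge_atTop 4, eventually_ge_atTop (4 / (ε₁ / 4)),
    Real.tendsto_log_atTop.eventually_ge_atTop ((|C₁| + C₂) / ε₁),
    Real.tendsto_log_atTop.eventually_ge_atTop (C₀ / ε₁)] with T hT4 hT2 hT3 hT5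
  have hpi := Real.pi_pos
  have hT0 : 0 < T := by linarith
  have hlogT : 0 ≤ Real.log T := Real.log_nonneg (by linarith)
  rw [div_le_iff₀ hε₁0] at hT3 hT5
  rw [div_le_iff₀ hη, mul_comm] at hT2
  have hC₀0 : 0 ≤ C₀ := by positivity
  have hlow := hC₂ (ε₁ / 4) T hη hε₁1 hT2
  set r := T / (1 + δ) with hr
  have hr0 : 0 < r := by positivity
  have hrT : r ≤ T := by rw [hr, div_le_iff₀ (by positivity)]; nlinarith
  have hr2 : 2 ≤ r := by rw [hr, le_div_iff₀ (by positivity)]; nlinarith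
  have hup := hC₁ r hr2
  have hJ := meanLogXi_sub_le hr0 hrT
  set n : ℝ := ∑ u ∈ centeredXiZeros T, (analyticOrderNatAt centeredXi u : ℝ) with hn
  have hn0 : 0 ≤ n := by positivity
  have hnN : n ≤ 2 * zeroCount T + C₀ := by
    rw [hn, hC₀]
    exact_mod_cast sum_analyticOrderNatAt_centeredXi_le (R := T)
  set X := T * Real.log T with hX
  have hX0 : 0 ≤ X := by positivity
  have hlogdiff : Real.log T - Real.log r ≤ δ := by
    rw [hr, Real.log_div hT0.ne' (by positivity)]
    have := Real.log_le_sub_one_of_pos (show 0 < 1 + δ by positivity)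
    linarith
  have hnδ : meanLogXi T - meanLogXi r ≤ n * δ := hJ.trans (by gcongr)
  have hCX : (|C₁| + C₂) * T ≤ ε₁ * X := by
    calc _ ≤ (Real.log T * ε₁) * T := by gcongr
      _ = _ := by rw [hX]; ring
  have hC₀X : C₀ ≤ ε₁ * X := by
    calc C₀ ≤ C₀ * T := by nlinarith
      _ ≤ (Real.log T * ε₁) * T := by gcongr
      _ = _ := by rw [hX]; ring
  have hC₁r : C₁ * r ≤ |C₁| * T := by
    calc _ ≤ |C₁| * r := by gcongr; exact le_abs_self _
      _ ≤ _ := by gcongr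
  have hrX : r * Real.log r / Real.pi ≤ X / (1 + δ) / Real.pi := by
    gcongr
    rw [hr, hX, mul_comm T, mul_div_assoc, mul_comm]
    have : Real.log (T / (1 + δ)) ≤ Real.log T := Real.log_le_log hr0 hrT
    gcongr
  have hmain : X * (1 - 1 / (1 + δ)) / Real.pi - 2 * (ε₁ * X) ≤ n * δ := by
    have e : X * (1 - 1 / (1 + δ)) / Real.pi = X / Real.pi - X / (1 + δ) / Real.pi := by
      ring
    rw [e]
    have : 4 * (ε₁ / 4) * X = ε₁ * X := by ring
    nlinarith
  have hδ2 : δ * (1 - δ) ≤ 1 - 1 / (1 + δ) := by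
    have : 1 - 1 / (1 + δ) = δ / (1 + δ) := by field_simp; ring
    rw [this, le_div_iff₀ (by positivity)]
    nlinarith [pow_pos hδ0 3]
  have hmain2 : X * (1 - δ) / Real.pi - X * (δ / 30) ≤ n := by
    have h1 : X * (δ * (1 - δ)) / Real.pi ≤ X * (1 - 1 / (1 + δ)) / Real.pi := by gcongr
    have h2 : δ * (X * (1 - δ) / Real.pi - X * (δ / 30)) ≤ δ * n := by
      have : δ * (X * (1 - δ) / Real.pi - X * (δ / 30)) =
          X * (δ * (1 - δ)) / Real.pi - 2 * (ε₁ * X) := by rw [hε₁]; ring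
      rw [this]; linarith
    exact le_of_mul_le_mul_left h2 hδ0
  have hpi4 : 1 / 4 ≤ 1 / Real.pi := by
    have := Real.pi_lt_four
    gcongr
  have hε₁δ : ε₁ ≤ δ / 60 := by
    have : δ ≤ 1 := by linarith
    rw [hε₁]; nlinarith
  have hXδ : 0 ≤ X * δ := by positivity
  have h3 : X * δ * (1 / 4) ≤ X * δ * (1 / Real.pi) := by gcongr
  have h4 : ε₁ * X ≤ δ / 60 * X := by gcongr
  have hL : (1 - ε) * (T * L T) = (X * (1 - ε) * (1 / Real.pi)) / 2 := by
    rw [L, hX]; ring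
  have h5 : X * (1 - δ) / Real.pi = X * (1 - ε) * (1 / Real.pi) + X * δ * (1 / Real.pi) := by
    rw [hδ]; ring
  rw [hL]
  rw [h5] at hmain2
  linarith

/-! ### Counting pairs of zeros -/

theorem pairCount_mono {S S' : Finset (ℂ × ℂ)} (h : S ⊆ S') : pairCount S ≤ pairCount S' :=
  Finset.sum_le_sum_of_subset h

open Classical in
theorem pairCount_union_le (S S' : Finset (ℂ × ℂ)) :
    pairCount (S ∪ S') ≤ pairCount S + pairCount S' := by
  rw [pairCount, pairCount, pairCount, ← Finset.sum_union_inter]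
  exact Nat.le_add_right _ _

theorem pairCount_add_pairCount_le {S S' U : Finset (ℂ × ℂ)} (hS : S ⊆ U) (hS' : S' ⊆ U)
    (hd : Disjoint S S') : pairCount S + pairCount S' ≤ pairCount U := by
  classical
  rw [pairCount, pairCount, ← Finset.sum_union hd]
  exact Finset.sum_le_sum_of_subset (Finset.union_subset hS hS')

theorem zeros_mono {T T' : ℝ} (h : T ≤ T') : zeros T ⊆ zeros T' := fun ρ hρ => by
  rw [mem_zeros] at *
  exact ⟨hρ.1, hρ.2.1, hρ.2.2.1, hρ.2.2.2.1, hρ.2.2.2.2.trans h⟩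

theorem mem_zeros_of_im_le {T T' : ℝ} {ρ : ℂ} (h : ρ ∈ zeros T) (h' : ρ.im ≤ T') :
    ρ ∈ zeros T' := by
  rw [mem_zeros] at *
  exact ⟨h.1, h.2.1, h.2.2.1, h.2.2.2.1, h'⟩

theorem zeroCount_le_NCirc (T : ℝ) : zeroCount T ≤ NCirc T := by
  classical
  rw [zeroCount, NCirc, pairCount]
  calc ∑ ρ ∈ zeros T, mult ρ ≤ ∑ ρ ∈ zeros T, mult ρ * mult ρ :=
        Finset.sum_le_sum fun ρ _ => Nat.le_mul_self _
    _ = ∑ p ∈ (zeros T).image fun ρ => (ρ, ρ), mult p.1 * mult p.2 := by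
        rw [Finset.sum_image fun a _ b _ h => (Prod.mk.inj h).1]
    _ ≤ _ := by
        refine Finset.sum_le_sum_of_subset fun p hp => ?_
        obtain ⟨ρ, hρ, rfl⟩ := Finset.mem_image.1 hp
        simp [hρ]

/-! ### Growth of the main term `T L` -/

theorem L_nonneg {T : ℝ} (hT : 1 ≤ T) : 0 ≤ L T :=
  mul_nonneg (by have := Real.pi_pos; positivity) (Real.log_nonneg hT)

theorem L_mono {S T : ℝ} (hS : 0 < S) (h : S ≤ T) : L S ≤ L T := by
  rw [L, L]
  have := Real.pi_pos
  have := Real.log_le_log hS h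
  gcongr

theorem tendsto_L : Tendsto L atTop atTop :=
  Real.tendsto_log_atTop.const_mul_atTop (by have := Real.pi_pos; positivity)

theorem tendsto_mul_L : Tendsto (fun T => T * L T) atTop atTop :=
  tendsto_id.atTop_mul_atTop₀ tendsto_L

theorem tendsto_div_log_sq : Tendsto (fun T : ℝ => T / Real.log T ^ 2) atTop atTop := by
  rw [tendsto_atTop]
  intro b
  have h := (isLittleO_iff.1 (Real.isLittleO_pow_log_id_atTop (n := 2)))
    (show 0 < 1 / (|b| + 1) by positivity)
  filter_upwards [h, eventually_gt_atTop 1] with T hT hT1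
  have hlog := Real.log_pos hT1
  rw [le_div_iff₀ (by positivity)]
  simp only [id, Real.norm_eq_abs, abs_of_pos (show 0 < T by linarith), abs_of_pos (pow_pos hlog 2)]
    at hT
  rw [one_div_mul_eq_div, le_div_iff₀ (by positivity)] at hT
  nlinarith [le_abs_self b, pow_pos hlog 2]

/-- The main term `T L` at height `c T / log² T` is negligible against its value at `T`. -/
theorem eventually_low_mul_L_le {c ε : ℝ} (hc : 0 < c) (hε : 0 < ε) :
    ∀ᶠ T : ℝ in atTop, 1 ≤ c * (T / Real.log T ^ 2) ∧ c * (T / Real.log T ^ 2) ≤ T / 2 ∧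
      c * (T / Real.log T ^ 2) * L (c * (T / Real.log T ^ 2)) ≤ ε * (T * L T) := by
  filter_upwards [(tendsto_div_log_sq.const_mul_atTop hc).eventually_ge_atTop 1,
    Real.tendsto_log_atTop.eventually_ge_atTop 1,
    Real.tendsto_log_atTop.eventually_ge_atTop (2 * c),
    Real.tendsto_log_atTop.eventually_ge_atTop (c / ε), eventually_ge_atTop 1] with T h1 h2 h3 h4 hT
  have hsq : Real.log T ≤ Real.log T ^ 2 := by nlinarith
  have hle (b : ℝ) (hb : 0 < b) (h : c / b ≤ Real.log T) : c * (T / Real.log T ^ 2) ≤ b * T := by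
    rw [div_le_iff₀ hb] at h
    rw [mul_div_assoc', div_le_iff₀ (by positivity)]
    calc c * T ≤ (Real.log T * b) * T := by gcongr
      _ ≤ (Real.log T ^ 2 * b) * T := by gcongr
      _ = _ := by ring
  have hhalf : c * (T / Real.log T ^ 2) ≤ T / 2 := by
    have := hle (1 / 2) (by norm_num) (by linarith)
    linarith
  refine ⟨h1, hhalf, ?_⟩
  have hLL := L_mono (S := c * (T / Real.log T ^ 2)) (T := T) (by linarith) (by linarith)
  have := L_nonneg h1
  calc _ ≤ (ε * T) * L T := by
        have := hle ε hε h4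
        gcongr
    _ = _ := by ring

theorem tendsto_density_iff_isLittleO {M : ℝ} : HasLimitingDensity 0 M 1 ↔
    (fun T : ℝ => (pairCount (nearPairs 0 M T) : ℝ) - T * L T) =o[atTop] fun T => T * L T := by
  have hpos : ∀ᶠ T : ℝ in atTop, 0 < T * L T := tendsto_mul_L.eventually_gt_atTop 0
  rw [isLittleO_iff_tendsto' (hpos.mono fun T hT h => absurd h hT.ne'), HasLimitingDensity]
  have e : (fun T : ℝ => ((pairCount (nearPairs 0 M T) : ℝ) - T * L T) / (T * L T)) =ᶠ[atTop]
      fun T => density 0 M T - 1 := by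
    filter_upwards [hpos] with T hT
    rw [density, sub_div, div_self hT.ne']
  rw [tendsto_congr' e]
  constructor
  · intro h; simpa using h.sub_const 1
  · intro h; simpa using h.add_const 1

/-! ### From the Essential Simplicity Hypothesis to the density -/

open Classical in
theorem NCirc_le_add (M T : ℝ) (hM : 0 < M) : NCirc T ≤
    pairCount (nearPairs 0 M T) + NCirc (T / Real.log T ^ 2) := by
  refine le_trans (pairCount_mono fun p hp => ?_) (pairCount_union_le _ _)
  simp only [Finset.mem_filter, Finset.mem_product] at hp
  obtain ⟨⟨h1, h2⟩, h3⟩ := hp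
  rw [Finset.mem_union]
  by_cases h : p.1.im ≤ T / Real.log T ^ 2
  · right
    simp only [Finset.mem_filter, Finset.mem_product]
    exact ⟨⟨mem_zeros_of_im_le h1 h, mem_zeros_of_im_le h2 (h3 ▸ h)⟩, h3⟩
  · left
    push Not at h
    simp only [nearPairs, closePairs, Finset.mem_filter, Finset.mem_product]
    refine ⟨⟨⟨h1, h2⟩, h, h3 ▸ h, ?_⟩, ?_, ?_⟩
    · rw [h3]; simpa using hM.le
    · rw [h3]; norm_num
    · rw [h3]; norm_num

-- The two terms `N T lam` account for the two signs of `γ - γ'`, exchanged by swapping the pair.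
open Classical in
theorem pairCount_nearPairs_le {M T lam : ℝ}
    (h : ∀ p ∈ nearPairs 0 M T, |(p.1.im - p.2.im) * L T| ≤ lam) (hL : 0 < L T) :
    pairCount (nearPairs 0 M T) ≤ NCirc T + (N T lam + N T lam) := by
  have hswap : pairCount {p ∈ zeros T ×ˢ zeros T |
      0 < (p.2.im - p.1.im) * L T ∧ (p.2.im - p.1.im) * L T ≤ lam} = N T lam := by
    refine Finset.sum_nbij' Prod.swap Prod.swap ?_ ?_ ?_ ?_ ?_
    · intro p hp
      simp only [Finset.mem_filter, Finset.mem_product] at hp ⊢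
      exact ⟨hp.1.symm, hp.2⟩
    · intro p hp
      simp only [Finset.mem_filter, Finset.mem_product] at hp ⊢
      exact ⟨hp.1.symm, hp.2⟩
    · simp
    · simp
    · intro p _; simp [mul_comm]
  rw [← hswap]
  nth_rewrite 2 [hswap]
  refine le_trans (pairCount_mono fun p hp => ?_) ((pairCount_union_le
    {p ∈ zeros T ×ˢ zeros T | p.1.im = p.2.im} _).trans
    (add_le_add_right (pairCount_union_le
      {p ∈ zeros T ×ˢ zeros T | 0 < (p.2.im - p.1.im) * L T ∧ (p.2.im - p.1.im) * L T ≤ lam}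
      {p ∈ zeros T ×ˢ zeros T | 0 < (p.1.im - p.2.im) * L T ∧ (p.1.im - p.2.im) * L T ≤ lam}) _))
  have h1 := abs_le.1 (h p hp)
  simp only [nearPairs, closePairs, Finset.mem_filter, Finset.mem_product] at hp
  have h2 := hp.1.1
  simp only [Finset.mem_union, Finset.mem_filter, Finset.mem_product]
  rcases lt_trichotomy p.1.im p.2.im with h3 | h3 | h3
  · right; left
    exact ⟨h2, mul_pos (sub_pos.2 h3) hL, by nlinarith⟩
  · left; exact ⟨h2, h3⟩
  · right; right
    exact ⟨h2, mul_pos (sub_pos.2 h3) hL, h1.2⟩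

theorem AHPairs.exists_bound (hAH : AHPairs) {M : ℝ} (hM : 0 < M) : ∃ lam : ℝ → ℝ,
    Tendsto lam atTop (𝓝 0) ∧ ∀ᶠ T : ℝ in atTop, ∀ p ∈ nearPairs 0 M T,
      |(p.1.im - p.2.im) * L T| ≤ lam T := by
  obtain ⟨R, C, T₀, hRpos, -, hR0, hAH⟩ := hAH M hM
  have hlim : Tendsto (fun T => |C| * R T) atTop (𝓝 0) := by simpa using hR0.const_mul |C|
  refine ⟨fun T => |C| * R T, hlim, ?_⟩
  filter_upwards [eventually_ge_atTop T₀,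
    hlim.eventually_lt_const (show (0 : ℝ) < 1 / 16 by norm_num)] with T hT hsmall p hp
  have hp' : p ∈ closePairs T M := by
    classical
    rw [nearPairs, Finset.mem_filter] at hp
    exact hp.1
  obtain ⟨k, hk⟩ := hAH T hT p hp'
  simp only [nearPairs, Finset.mem_filter] at hp
  obtain ⟨-, h1, h2⟩ := hp
  norm_num at h1 h2
  have hk' : |(p.1.im - p.2.im) * L T - (k : ℝ) / 2| ≤ (|(k : ℝ)| + 1) * (|C| * R T) := by
    refine hk.trans ?_
    have := hRpos T hT
    have h3 : C * ((|(k : ℝ)| + 1) * R T) ≤ |C| * ((|(k : ℝ)| + 1) * R T) := by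
      gcongr
      exact le_abs_self C
    linarith
  -- In the window, `|k| / 2 ≤ 1/4 + (|k| + 1) / 16`, which gives `|k| ≤ 5/7`.
  have hk0 : k = 0 := by
    have h4 : |(k : ℝ)| / 2 ≤ 1 / 4 + (|(k : ℝ)| + 1) * (1 / 16) := by
      have h5 : |(k : ℝ) / 2| ≤ |(p.1.im - p.2.im) * L T| +
          |(p.1.im - p.2.im) * L T - (k : ℝ) / 2| := by
        have := abs_sub ((p.1.im - p.2.im) * L T) ((p.1.im - p.2.im) * L T - (k : ℝ) / 2)
        rwa [sub_sub_cancel] at this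
      have h6 : |(p.1.im - p.2.im) * L T| ≤ 1 / 4 := abs_le.2 ⟨by linarith, by linarith⟩
      have h7 : (|(k : ℝ)| + 1) * (|C| * R T) ≤ (|(k : ℝ)| + 1) * (1 / 16) := by gcongr
      rw [abs_div, abs_two] at h5
      linarith
    have h8 : |(k : ℝ)| < 1 := by linarith
    rw [← Int.cast_abs] at h8
    exact Int.abs_lt_one_iff.1 (by exact_mod_cast h8)
  subst hk0
  simpa using hk'

theorem hasLimitingDensity_of_ESH (hAH : AHPairs) {M : ℝ} (hM : 0 < M) (h : ESH) :
    HasLimitingDensity 0 M 1 := by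
  rw [tendsto_density_iff_isLittleO, isLittleO_iff]
  intro ε hε
  obtain ⟨lam, hlam0, hlam⟩ := hAH.exists_bound hM
  have hN := isLittleO_iff.1 (h.2 lam hlam0) (show 0 < ε / 4 by positivity)
  have hC := isLittleO_iff.1 h.1 (show 0 < ε / 4 by positivity)
  have hC1 := tendsto_div_log_sq.eventually (isLittleO_iff.1 h.1 (show (0 : ℝ) < 1 by norm_num))
  filter_upwards [hN, hC, hC1, hlam, eventually_low_mul_L_le one_pos (show 0 < ε / 4 by positivity),
    tendsto_L.eventually_gt_atTop 0, eventually_gt_atTop 1] with T h1 h2 h3 h4 h5 h6 hT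
  have hup : (pairCount (nearPairs 0 M T) : ℝ) ≤ NCirc T + (N T (lam T) + N T (lam T)) := by
    exact_mod_cast pairCount_nearPairs_le h4 h6
  have hlow : (NCirc T : ℝ) ≤ pairCount (nearPairs 0 M T) + NCirc (T / Real.log T ^ 2) := by
    exact_mod_cast NCirc_le_add M T hM
  have hY : 0 < T * L T := by positivity
  simp only [one_mul] at h5
  have hS0 : 0 ≤ T / Real.log T ^ 2 * L (T / Real.log T ^ 2) :=
    mul_nonneg (by linarith [h5.1]) (L_nonneg h5.1)
  rw [Real.norm_eq_abs, Real.norm_of_nonneg hY.le] at h1 h2 ⊢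
  rw [Real.norm_eq_abs, Real.norm_of_nonneg hS0, one_mul] at h3
  have h1' := (abs_le.1 h1).2
  have h2' := abs_le.1 h2
  have h3' := (abs_le.1 h3).2
  have := h5.2.2
  rw [abs_le]
  constructor <;> nlinarith

/-! ### From the density to the Essential Simplicity Hypothesis -/

open Classical in
/-- The pairs of zeros up to height `T` at normalized distance at most `m`. -/
noncomputable def allClosePairs (m T : ℝ) : Finset (ℂ × ℂ) :=
  {p ∈ zeros T ×ˢ zeros T | |(p.1.im - p.2.im) * L T| ≤ m}

-- With `S = T / log² T`, the ordinates of a close pair differ by at most `m / L ≤ S`, so if one is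
-- at most `S` then both are at most `2S`. The pair stays close at height `2S` because `L` is
-- smaller there.
open Classical in
theorem pairCount_allClosePairs_le {m M T : ℝ} (hmM : m ≤ M) (hm : m < 1 / 4)
    (hL : 0 < L T) (hmT : m ≤ T / Real.log T ^ 2 * L T)
    (hT0 : 1 ≤ T / Real.log T ^ 2) (hT : 2 * (T / Real.log T ^ 2) ≤ T) :
    pairCount (allClosePairs m T) ≤
      pairCount (nearPairs 0 M T) + pairCount (allClosePairs m (2 * (T / Real.log T ^ 2))) := by
  refine le_trans (pairCount_mono fun p hp => ?_) (pairCount_union_le _ _)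
  simp only [allClosePairs, Finset.mem_filter, Finset.mem_product] at hp
  obtain ⟨⟨h1, h2⟩, h3⟩ := hp
  set S := T / Real.log T ^ 2 with hS
  rw [Finset.mem_union]
  by_cases h : S < p.1.im ∧ S < p.2.im
  · left
    simp only [nearPairs, closePairs, Finset.mem_filter, Finset.mem_product]
    have h4 := abs_le.1 h3
    refine ⟨⟨⟨h1, h2⟩, h.1, h.2, h3.trans hmM⟩, ?_, ?_⟩ <;> norm_num <;> linarith
  · right
    have hdiff : |p.1.im - p.2.im| ≤ S := by
      rw [abs_mul, abs_of_pos hL] at h3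
      exact le_of_mul_le_mul_right (h3.trans hmT) hL
    have h5 := abs_le.1 hdiff
    have hboth : p.1.im ≤ 2 * S ∧ p.2.im ≤ 2 * S := by
      by_contra! hcon
      apply h
      by_cases h6 : p.1.im ≤ 2 * S
      · have := hcon h6
        constructor <;> linarith
      · push Not at h6
        constructor <;> linarith
    simp only [allClosePairs, Finset.mem_filter, Finset.mem_product]
    refine ⟨⟨mem_zeros_of_im_le h1 hboth.1, mem_zeros_of_im_le h2 hboth.2⟩, ?_⟩
    refine le_trans ?_ h3
    rw [abs_mul, abs_mul, abs_of_pos hL]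
    gcongr
    rw [abs_of_nonneg (L_nonneg (by linarith))]
    exact L_mono (by linarith) hT

theorem NCirc_add_N_le {m lam T : ℝ} (hm : 0 ≤ m) (hlam : lam ≤ m) :
    NCirc T + N T lam ≤ pairCount (allClosePairs m T) := by
  classical
  refine pairCount_add_pairCount_le (fun p hp => ?_) (fun p hp => ?_) ?_
  · simp only [allClosePairs, Finset.mem_filter] at hp ⊢
    refine ⟨hp.1, ?_⟩
    rw [hp.2]
    simpa using hm
  · simp only [allClosePairs, Finset.mem_filter] at hp ⊢
    refine ⟨hp.1, ?_⟩
    rw [abs_of_pos hp.2.1]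
    exact hp.2.2.trans hlam
  · rw [Finset.disjoint_filter]
    intro p _ h1 h2
    rw [h1] at h2
    simp at h2

/-- A crude bound for the low-lying pairs, on which the density at `T` gives no information. The
count at `T` is at most `2 T L` plus the count at `2T / log² T ≤ T / 2`, and `2 T L + 4 (T / 2) L =
4 T L` closes the recursion. -/
theorem exists_pairCount_allClosePairs_le {m M : ℝ} (hmM : m ≤ M) (hm : m < 1 / 4)
    (h : HasLimitingDensity 0 M 1) : ∃ K : ℝ, ∀ T : ℝ, 1 ≤ T →
      (pairCount (allClosePairs m T) : ℝ) ≤ 4 * (T * L T) + K := by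
  rw [tendsto_density_iff_isLittleO] at h
  have hnear := isLittleO_iff.1 h one_pos
  obtain ⟨T₀, hT₀⟩ := eventually_atTop.1 (hnear.and ((eventually_low_mul_L_le two_pos one_pos).and
    ((tendsto_L.eventually_ge_atTop 1).and (tendsto_div_log_sq.eventually_ge_atTop (max m 1)))))
  set T₁ := max T₀ 1 with hT₁
  have hbase : ∀ T : ℝ, T ≤ T₁ → pairCount (allClosePairs m T) ≤
      pairCount (zeros T₁ ×ˢ zeros T₁) := by
    classical
    intro T hT
    refine pairCount_mono ((Finset.filter_subset _ _).trans ?_)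
    exact Finset.product_subset_product (zeros_mono hT) (zeros_mono hT)
  refine ⟨pairCount (zeros T₁ ×ˢ zeros T₁), fun T hT => ?_⟩
  -- Each step of the recursion at least halves the height, so the induction runs on `n` with `T < 2
  -- ^ n * T₁`.
  obtain ⟨n, hn⟩ := pow_unbounded_of_one_lt (T / T₁) (show (1 : ℝ) < 2 by norm_num)
  have hT₁0 : 0 < T₁ := lt_of_lt_of_le one_pos (le_max_right _ _)
  rw [div_lt_iff₀ hT₁0] at hn
  have hsmall : ∀ T : ℝ, 1 ≤ T → T ≤ T₁ → (pairCount (allClosePairs m T) : ℝ) ≤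
      4 * (T * L T) + pairCount (zeros T₁ ×ˢ zeros T₁) := by
    intro T hT h1
    have h2 : (pairCount (allClosePairs m T) : ℝ) ≤ pairCount (zeros T₁ ×ˢ zeros T₁) := by
      exact_mod_cast hbase T h1
    have := L_nonneg hT
    have : 0 ≤ 4 * (T * L T) := by positivity
    linarith
  induction n generalizing T with
  | zero => exact hsmall T hT (by simpa using hn.le)
  | succ n ih =>
    by_cases h1 : T ≤ T₁
    · exact hsmall T hT h1
    push Not at h1
    obtain ⟨hn1, ⟨hl1, hl2, -⟩, hL1, hlow⟩ := hT₀ T ((le_max_left _ _).trans h1.le)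
    have hlowm := (le_max_left _ _).trans hlow
    have hlow1 := (le_max_right _ _).trans hlow
    have hstep := pairCount_allClosePairs_le hmM hm (T := T) (by linarith) (by nlinarith)
      (by linarith) (by linarith)
    have hstep' : (pairCount (allClosePairs m T) : ℝ) ≤ pairCount (nearPairs 0 M T) +
        pairCount (allClosePairs m (2 * (T / Real.log T ^ 2))) := by exact_mod_cast hstep
    have hrec := ih (2 * (T / Real.log T ^ 2)) hl1 (by rw [pow_succ] at hn; linarith)
    have hY : 0 ≤ T * L T := by positivity
    rw [Real.norm_eq_abs, Real.norm_of_nonneg hY, one_mul] at hn1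
    have h2 := (abs_le.1 hn1).2
    have h3 : 2 * (T / Real.log T ^ 2) * L (2 * (T / Real.log T ^ 2)) ≤ T / 2 * L T := by
      have := L_nonneg hl1
      have := L_mono (S := 2 * (T / Real.log T ^ 2)) (T := T) (by linarith) (by linarith)
      gcongr
    linarith

theorem ESH_of_hasLimitingDensity {M : ℝ} (hM : 0 < M) (h : HasLimitingDensity 0 M 1) : ESH := by
  -- Distance at most `m` puts a pair both within the range `M` and strictly inside the window
  -- `(-1/4, 1/4]`.
  set m := min M (1 / 8) with hm
  have hm0 : 0 < m := lt_min hM (by norm_num)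
  have hmM : m ≤ M := min_le_left _ _
  have hm4 : m < 1 / 4 := (min_le_right _ _).trans_lt (by norm_num)
  obtain ⟨K, hK⟩ := exists_pairCount_allClosePairs_le hmM hm4 h
  rw [tendsto_density_iff_isLittleO] at h
  have hall : ∀ ε : ℝ, 0 < ε → ∀ᶠ T : ℝ in atTop,
      (pairCount (allClosePairs m T) : ℝ) ≤ (1 + ε) * (T * L T) := by
    intro ε hε
    filter_upwards [isLittleO_iff.1 h (show 0 < ε / 2 by positivity),
      eventually_low_mul_L_le two_pos (show 0 < ε / 16 by positivity),
      tendsto_L.eventually_ge_atTop 1, tendsto_div_log_sq.eventually_ge_atTop (max m 1),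
      tendsto_mul_L.eventually_ge_atTop (K / (ε / 4)), eventually_ge_atTop 1]
      with T h1 h2 h3 h4 h5 hT
    obtain ⟨hl1, hl2, hl3⟩ := h2
    have hlowm := (le_max_left _ _).trans h4
    have hlow1 := (le_max_right _ _).trans h4
    have hstep := pairCount_allClosePairs_le hmM hm4 (T := T) (by linarith) (by nlinarith)
      (by linarith) (by linarith)
    have hstep' : (pairCount (allClosePairs m T) : ℝ) ≤ pairCount (nearPairs 0 M T) +
        pairCount (allClosePairs m (2 * (T / Real.log T ^ 2))) := by exact_mod_cast hstep
    have hrec := hK _ hl1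
    have hY : 0 ≤ T * L T := by positivity
    rw [Real.norm_eq_abs, Real.norm_of_nonneg hY] at h1
    have h6 := (abs_le.1 h1).2
    rw [div_le_iff₀ (by positivity)] at h5
    linarith
  have hcirc : ∀ ε : ℝ, 0 < ε → ε < 1 → ∀ᶠ T : ℝ in atTop,
      (1 - ε) * (T * L T) ≤ NCirc T := by
    intro ε hε hε1
    filter_upwards [eventually_mul_le_zeroCount hε hε1] with T hT
    exact hT.trans (by exact_mod_cast zeroCount_le_NCirc T)
  refine ⟨isLittleO_iff.2 fun ε hε => ?_, fun lam hlam => isLittleO_iff.2 fun ε hε => ?_⟩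
  · filter_upwards [hall ε hε, hcirc (min ε (1 / 2)) (by positivity)
      ((min_le_right _ _).trans_lt (by norm_num)), tendsto_mul_L.eventually_ge_atTop 0]
      with T h1 h2 hY
    rw [Real.norm_eq_abs, Real.norm_of_nonneg hY, abs_le]
    have h3 : (NCirc T : ℝ) ≤ pairCount (allClosePairs m T) := by
      exact_mod_cast (Nat.le_add_right _ _).trans (NCirc_add_N_le hm0.le le_rfl)
    have h4 : min ε (1 / 2) * (T * L T) ≤ ε * (T * L T) := by gcongr; exact min_le_left _ _
    constructor <;> linarith
  · filter_upwards [hall (ε / 2) (by positivity), hcirc (min (ε / 2) (1 / 2)) (by positivity)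
      ((min_le_right _ _).trans_lt (by norm_num)), tendsto_mul_L.eventually_ge_atTop 0,
      hlam.eventually_le_const hm0] with T h1 h2 hY hl
    rw [Real.norm_of_nonneg (by positivity), Real.norm_of_nonneg hY]
    have h3 : (NCirc T : ℝ) + N T (lam T) ≤ pairCount (allClosePairs m T) := by
      exact_mod_cast NCirc_add_N_le hm0.le hl
    have h4 : min (ε / 2) (1 / 2) * (T * L T) ≤ ε / 2 * (T * L T) := by
      gcongr; exact min_le_left _ _
    linarith

end ZetaPairs

theorem theorem1 (hAH : ZetaPairs.AHPairs) (M : ℝ) (hM : 0 < M) :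
    ZetaPairs.HasLimitingDensity 0 M 1 ↔ ZetaPairs.ESH :=
  ⟨ZetaPairs.ESH_of_hasLimitingDensity hM, ZetaPairs.hasLimitingDensity_of_ESH hAH hM⟩
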